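/- **Setting.** A *verifier family* with space bounds $l_V,l_M$ assigns to every input $x\in\{0,1\}^*$ a unitary $V_x$ acting on a register $\mathsf V$ of $l_V(|x|)$ private qubits and a register $\mathsf M$ of $l_M(|x|)$ witness qubits. The probability that it accepts $x$ with witness $\rho$ (a density operator on $\mathsf M$) is $\operatorname{tr}\bigl(\Pi_{\rm acc}\,V_x\,(|0\rangle\langle 0|^{\otimes l_V(|x|)}\otimes\rho)\,V_x^\dagger\bigr)$, where $\Pi_{\rm acc}$ projects onto the states whose first private qubit is $|1\rangle$. A *model* $\mathcal M$ of space-bounded unitary quantum computation specifies, for all $l_V,l_M:\mathbb Z_{\ge 0}\to\mathbb Z_{\ge 0}$, which verifier families are performed by its $(l_V,l_M)$-space-bounded machines. It is only required that machines can be used as subroutines: if $\{V_x\}$ is performed by an $(l_V,l_M)$-space-bounded machine, $d:\mathbb Z_{\ge 0}\to\mathbb Z_{\ge 0}$, and for each $n$ a sequence $P_n$ is given whose steps are Hadamard, NOT, CNOT and Toffoli gates on the $l_V(n)+d(n)$ private and $l_M(n)$ witness qubits, calls of $V_x$, and calls of $V_x^{-1}$ (both acting on the first $l_V(n)$ private qubits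 and the witness qubits), with at most $2^{K(l_V(n)+d(n)+l_M(n))}$ steps for a constant $K$, then the family that performs $P_{|x|}$ with subroutine $V_x$ on input $x$ is performed by an $(l_V+d,l_M)$-space-bounded machine. No bound is put on the running time. An example is the model of quantum circuits of Hadamard, NOT, CNOT and Toffoli gates whose successive gates are generated from $x$ by a classical control with at most $(n+1)\,2^{O(l_V(n)+l_M(n))}$ configurations, which may depend on $n=|x|$. For functions $c,s$, the class $\mathrm{QMA_{U}SPACE}_{\mathcal M}[l_V,l_M](c,s)$ consists of the promise problems $(A_{\rm yes},A_{\rm no})$ for which some $(l_V,l_M)$-space-bounded machine of $\mathcal M$ accepts every $x\in A_{\rm yes}$ with probability at least $c(|x|)$ for some witness, and every $x\in A_{\rm no}$ with probability at most $s(|x|)$ for all witnesses. **Theorem.** There is an absolute constant $C$ such that for all functions $p,l_V:\mathbb Z_{\ge 0}\to\mathbb Z_{\ge 1}$ and $l_M:\mathbb Z_{\ge 0}\to\mathbb Z_{\ge 0}$ and all $c,s:\mathbb Z_{\ge 0}\to[0,1]$ with $c(n)>s(n)$ for every $n$, there is a function $\delta:\mathbb Z_{\ge 0}\to\mathbb Z_{\ge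 0}$ with $$\delta(n)\le C\log_2\frac{p(n)}{c(n)-s(n)}\quad\text{for all } n,$$ such that for every model $\mathcal M$ of space-bounded unitary quantum computation $$\mathrm{QMA_{U}SPACE}_{\mathcal M}[l_V,l_M](c,s)\subseteq \mathrm{QMA_{U}SPACE}_{\mathcal M}[l_V+\delta,l_M]\bigl(1-2^{-p},2^{-p}\bigr).$$ -/

import Mathlib

noncomputable section

namespace SpaceQMA

open scoped ComplexOrder Matrix

/-! ### Qubits, unitaries, elementary gates -/

/-- Computational basis states of a set `κ` of qubits. -/
abbrev Basis (κ : Type) : Type := κ → Bool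

/-- Unitary transformations of the qubits in `κ`. -/
abbrev Unitary (κ : Type) [Fintype κ] [DecidableEq κ] : Type :=
  Matrix.unitaryGroup (Basis κ) ℂ

/-- The qubits of a pair of registers `(V, M)` of `a` private qubits and `b` witness qubits. -/
abbrev Reg (a b : ℕ) : Type := Fin a ⊕ Fin b

section Lift

variable {ι κ μ : Type}

open Classical in
/-- The operator `U` applied to the qubits selected by `e`, tensored with the identity on all the
other qubits. -/
def liftMatrix (e : ι ↪ κ) (U : Matrix (Basis ι) (Basis ι) ℂ) : Matrix (Basis κ) (Basis κ) ℂ :=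
  Matrix.of fun f g => if ∀ k, k ∉ Set.range e → f k = g k then U (f ∘ e) (g ∘ e) else 0

theorem extend_comp_emb (e : ι ↪ κ) (u : Basis ι) (f : Basis κ) :
    Function.extend e u f ∘ e = u := by
  funext i
  exact e.injective.extend_apply u f i

theorem extend_off (e : ι ↪ κ) (u : Basis ι) (f : Basis κ) (k : κ) (hk : k ∉ Set.range e) :
    Function.extend e u f k = f k :=
  Function.extend_apply' u f k (by simpa using hk)

theorem liftMatrix_mul [Fintype ι] [DecidableEq ι] [Fintype κ] [DecidableEq κ] (e : ι ↪ κ) (U W : Matrix (Basis ι) (Basis ι) ℂ) :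
    liftMatrix e (U * W) = liftMatrix e U * liftMatrix e W := by
  classical
  ext f h
  rw [Matrix.mul_apply]
  have hinj : Function.Injective (fun u : Basis ι => Function.extend e u f) := by
    intro u v huv
    have : Function.extend e u f ∘ e = Function.extend e v f ∘ e := by
      simp only at huv
      rw [huv]
    rwa [extend_comp_emb, extend_comp_emb] at this
  rw [← Fintype.sum_of_injective (fun u : Basis ι => Function.extend e u f) hinj
    (fun u => liftMatrix e U f (Function.extend e u f) * liftMatrix e W (Function.extend e u f) h)
    (fun g => liftMatrix e U f g * liftMatrix e W g h) ?_ (fun _ => rfl)]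
  · by_cases hfh : ∀ k, k ∉ Set.range e → f k = h k
    · have h1 : ∀ u : Basis ι, ∀ k, k ∉ Set.range e → f k = Function.extend e u f k :=
        fun u k hk => (extend_off e u f k hk).symm
      have h2 : ∀ u : Basis ι, ∀ k, k ∉ Set.range e → Function.extend e u f k = h k :=
        fun u k hk => (extend_off e u f k hk).trans (hfh k hk)
      simp only [liftMatrix, Matrix.of_apply, if_pos hfh, if_pos (h1 _), if_pos (h2 _),
        extend_comp_emb, Matrix.mul_apply]
    · have h2 : ∀ u : Basis ι, ¬ ∀ k, k ∉ Set.range e → Function.extend e u f k = h k := by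
        intro u hu
        exact hfh fun k hk => (extend_off e u f k hk).symm.trans (hu k hk)
      simp only [liftMatrix, Matrix.of_apply, if_neg hfh, if_neg (h2 _), mul_zero,
        Finset.sum_const_zero]
  · intro g hg
    have : ¬ ∀ k, k ∉ Set.range e → f k = g k := by
      intro hfg
      refine hg ⟨g ∘ e, ?_⟩
      funext k
      by_cases hk : k ∈ Set.range e
      · obtain ⟨i, rfl⟩ := hk
        exact e.injective.extend_apply _ _ i
      · exact (extend_off e _ f k hk).trans (hfg k hk)
    simp only [liftMatrix, Matrix.of_apply, if_neg this, zero_mul]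

theorem liftMatrix_one [Fintype ι] [Fintype κ] (e : ι ↪ κ) : liftMatrix e 1 = 1 := by
  classical
  ext f g
  simp only [liftMatrix, Matrix.of_apply, Matrix.one_apply]
  by_cases hfg : f = g
  · subst hfg
    simp
  · rw [if_neg hfg]
    split_ifs with h1 h2
    · refine absurd ?_ hfg
      funext k
      by_cases hk : k ∈ Set.range e
      · obtain ⟨i, rfl⟩ := hk
        exact congrFun h2 i
      · exact h1 k hk
    · rfl
    · rfl

theorem liftMatrix_star (e : ι ↪ κ) (U : Matrix (Basis ι) (Basis ι) ℂ) :
    liftMatrix e (star U) = star (liftMatrix e U) := by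
  classical
  ext f g
  simp only [liftMatrix, Matrix.of_apply, Matrix.star_apply]
  by_cases h : ∀ k, k ∉ Set.range e → f k = g k
  · rw [if_pos h, if_pos fun k hk => (h k hk).symm]
  · rw [if_neg h, if_neg fun h' => h fun k hk => (h' k hk).symm, star_zero]

variable [Fintype ι] [DecidableEq ι] [Fintype κ] [DecidableEq κ]
  [Fintype μ] [DecidableEq μ]

theorem liftMatrix_mem (e : ι ↪ κ) (U : Unitary ι) :
    liftMatrix e U.1 ∈ Matrix.unitaryGroup (Basis κ) ℂ := by
  rw [Matrix.mem_unitaryGroup_iff, ← liftMatrix_star, ← liftMatrix_mul,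
    Matrix.mem_unitaryGroup_iff.1 U.2, liftMatrix_one]

/-- A unitary applied to the qubits selected by `e`, as a unitary of all the qubits. -/
def lift (e : ι ↪ κ) : Unitary ι →* Unitary κ where
  toFun U := ⟨liftMatrix e U.1, liftMatrix_mem e U⟩
  map_one' := Subtype.ext (liftMatrix_one e)
  map_mul' U W := Subtype.ext (liftMatrix_mul e U.1 W.1)

theorem lift_lift (e : ι ↪ κ) (e' : κ ↪ μ) (U : Unitary ι) :
    lift e' (lift e U) = lift (e.trans e') U := by
  classical
  apply Subtype.ext
  ext f g
  have key : (∀ k, k ∉ Set.range (e.trans e') → f k = g k) ↔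
      (∀ k, k ∉ Set.range e' → f k = g k) ∧
        ∀ k, k ∉ Set.range e → (f ∘ e') k = (g ∘ e') k := by
    constructor
    · intro h
      refine ⟨fun k hk => h k ?_, fun k hk => h (e' k) ?_⟩
      · rintro ⟨i, hi⟩
        exact hk ⟨e i, hi⟩
      · rintro ⟨i, hi⟩
        exact hk ⟨i, e'.injective hi⟩
    · rintro ⟨h1, h2⟩ k hk
      by_cases hk' : k ∈ Set.range e'
      · obtain ⟨j, rfl⟩ := hk'
        refine h2 j ?_
        rintro ⟨i, hi⟩
        exact hk ⟨i, congrArg e' hi⟩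
      · exact h1 k hk'
  change liftMatrix e' (liftMatrix e U.1) f g = liftMatrix (e.trans e') U.1 f g
  simp only [liftMatrix, Matrix.of_apply, key, ite_and]
  split_ifs <;> rfl

end Lift

/-- The Hadamard transformation of one qubit. -/
def hadamardMatrix : Matrix (Basis (Fin 1)) (Basis (Fin 1)) ℂ :=
  Matrix.of fun f g => (if f 0 = true ∧ g 0 = true then -1 else 1) / ((Real.sqrt 2 : ℝ) : ℂ)

/-- Flip bit `0` if the `k` other bits are all `1`. -/
def flipTarget (k : ℕ) (f : Basis (Fin (k + 1))) : Basis (Fin (k + 1)) :=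
  if ∀ i : Fin k, f i.succ = true then Function.update f 0 (!f 0) else f

/-- The NOT of qubit `0` controlled by the `k` other qubits. -/
def controlledNotMatrix (k : ℕ) : Matrix (Basis (Fin (k + 1))) (Basis (Fin (k + 1))) ℂ :=
  Matrix.of fun f g => if f = flipTarget k g then 1 else 0

theorem hadamardMatrix_star : star hadamardMatrix = hadamardMatrix := by
  ext f g
  simp only [Matrix.star_apply, hadamardMatrix, Matrix.of_apply, and_comm (a := g 0 = true)]
  split_ifs <;> simp

theorem hadamardMatrix_mul_self : hadamardMatrix * hadamardMatrix = 1 := by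
  have h2 : ((Real.sqrt 2 : ℝ) : ℂ) * ((Real.sqrt 2 : ℝ) : ℂ) = 2 := by
    rw [← Complex.ofReal_mul, Real.mul_self_sqrt (by norm_num)]
    norm_num
  ext f g
  rw [Matrix.mul_apply, ← (Equiv.funUnique (Fin 1) Bool).symm.sum_comp, Fintype.sum_bool,
    Matrix.one_apply]
  have hfg : f = g ↔ f 0 = g 0 := by
    constructor
    · intro h
      rw [h]
    · intro h
      funext i
      rw [Subsingleton.elim i 0, h]
  simp only [hfg, hadamardMatrix, Matrix.of_apply, Equiv.funUnique_symm_apply,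
    uniqueElim_const, div_mul_div_comm, h2]
  cases f 0 <;> cases g 0 <;> norm_num

theorem flipTarget_flipTarget (k : ℕ) (f : Basis (Fin (k + 1))) :
    flipTarget k (flipTarget k f) = f := by
  by_cases h : ∀ i : Fin k, f i.succ = true
  · have h' : ∀ i : Fin k, Function.update f 0 (!f 0) i.succ = true := by
      intro i
      rw [Function.update_of_ne (Fin.succ_ne_zero i)]
      exact h i
    simp only [flipTarget, if_pos h, if_pos h']
    simp
  · simp only [flipTarget, if_neg h]

theorem controlledNotMatrix_star (k : ℕ) :
    star (controlledNotMatrix k) = controlledNotMatrix k := by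
  ext f g
  have : g = flipTarget k f ↔ f = flipTarget k g := by
    constructor <;> rintro rfl <;> rw [flipTarget_flipTarget]
  simp only [Matrix.star_apply, controlledNotMatrix, Matrix.of_apply, this]
  split_ifs <;> simp

theorem controlledNotMatrix_mul_self (k : ℕ) :
    controlledNotMatrix k * controlledNotMatrix k = 1 := by
  ext f g
  rw [Matrix.mul_apply, Finset.sum_eq_single (flipTarget k g)]
  · simp [controlledNotMatrix, flipTarget_flipTarget, Matrix.one_apply]
  · intro b _ hb
    simp [controlledNotMatrix, hb]
  · simp

/-- The Hadamard transformation as a unitary. -/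
def hadamard : Unitary (Fin 1) :=
  ⟨hadamardMatrix, by
    rw [Matrix.mem_unitaryGroup_iff, hadamardMatrix_star, hadamardMatrix_mul_self]⟩

/-- The `k`-fold controlled NOT as a unitary. -/
def controlledNot (k : ℕ) : Unitary (Fin (k + 1)) :=
  ⟨controlledNotMatrix k, by
    rw [Matrix.mem_unitaryGroup_iff, controlledNotMatrix_star, controlledNotMatrix_mul_self]⟩

/-- Elementary gates on the qubits `κ`: Hadamard, and the classical reversible gates
NOT (`k = 0`), CNOT (`k = 1`) and Toffoli (`k = 2`), placed on distinct qubits. -/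
inductive Gate (κ : Type) : Type
  | had (i : κ) : Gate κ
  | cnot (k : Fin 3) (e : Fin (k.val + 1) ↪ κ) : Gate κ

/-- Placing one wire. -/
def wire {κ : Type} (i : κ) : Fin 1 ↪ κ := ⟨fun _ => i, fun _ _ _ => Subsingleton.elim _ _⟩

/-- The unitary of an elementary gate. -/
def Gate.eval {κ : Type} [Fintype κ] [DecidableEq κ] : Gate κ → Unitary κ
  | .had i => lift (wire i) hadamard
  | .cnot k e => lift e (controlledNot k.val)

/-- The unitary of a circuit; the head of the list is applied first. -/
def evalCircuit {κ : Type} [Fintype κ] [DecidableEq κ] : List (Gate κ) → Unitary κ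
  | [] => 1
  | g :: gs => evalCircuit gs * g.eval

/-! ### Subroutine calls -/

/-- The old registers `(V, M)` inside the new registers `(V', M)`, where `V'` has `d` more private
qubits than `V`: the qubits of `V` are the first ones of `V'`. -/
def regEmb (a d b : ℕ) : Reg a b ↪ Reg (a + d) b :=
  (Fin.castAddEmb d).sumMap (Function.Embedding.refl (Fin b))

/-- One step of a computation that uses a unitary of `(V, M)` as a subroutine and `d` additional
private qubits: an elementary gate, a call of the subroutine, or a call of its inverse. -/
inductive Step (a d b : ℕ) : Type
  | gate (g : Gate (Reg (a + d) b)) : Step a d b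
  | call : Step a d b
  | callInv : Step a d b

/-- The unitary of a step when the subroutine is `U`. -/
def Step.eval {a d b : ℕ} (U : Unitary (Reg a b)) : Step a d b → Unitary (Reg (a + d) b)
  | .gate g => g.eval
  | .call => lift (regEmb a d b) U
  | .callInv => lift (regEmb a d b) U⁻¹

/-- The unitary of a sequence of steps when the subroutine is `U`; the head of the list is
applied first. -/
def evalSteps {a d b : ℕ} (U : Unitary (Reg a b)) : List (Step a d b) → Unitary (Reg (a + d) b)
  | [] => 1
  | t :: ts => evalSteps U ts * t.eval U

/-! ### Space-bounded unitary computation models -/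

/-- What a verifier does: a unitary `V x` of `lV |x| + lM |x|` qubits for every input `x`. -/
abbrev Family (lV lM : ℕ → ℕ) : Type :=
  ∀ x : List Bool, Unitary (Reg (lV x.length) (lM x.length))

/-- A model of space-bounded unitary quantum computation. It says which families of unitaries are
performed by its `(lV, lM)`-space-bounded machines, for all space bounds `lV` and `lM`. The only
thing asked of a model is that machines can be used as subroutines: from a machine, one gets
another machine, with `d` additional private qubits, by fixing for each input length a sequence of
elementary gates and of calls of the given machine and its inverse (of length at most
exponential in the space). -/
structure UnitaryModel where
  verifiers (lV lM : ℕ → ℕ) : Set (Family lV lM)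
  subroutine {lV lM : ℕ → ℕ} {V : Family lV lM} (hV : V ∈ verifiers lV lM) (d : ℕ → ℕ) (K : ℕ)
    (P : ∀ n, List (Step (lV n) (d n) (lM n)))
    (hP : ∀ n, (P n).length ≤ 2 ^ (K * (lV n + d n + lM n))) :
    (fun x : List Bool => evalSteps (V x) (P x.length)) ∈ verifiers (lV + d) lM

/-! ### The class of problems -/

/-- A promise problem. -/
structure PromiseProblem where
  yes : Set (List Bool)
  no : Set (List Bool)
  disjoint : Disjoint yes no

/-- Quantum states (density operators) of `b` qubits. -/
def IsState {b : ℕ} (ρ : Matrix (Basis (Fin b)) (Basis (Fin b)) ℂ) : Prop :=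
  ρ.PosSemidef ∧ ρ.trace = 1

/-- The state `(|0⟩⟨0|)^{⊗ a} ⊗ ρ` of the registers `(V, M)`. -/
def initialState (a : ℕ) {b : ℕ} (ρ : Matrix (Basis (Fin b)) (Basis (Fin b)) ℂ) :
    Matrix (Basis (Reg a b)) (Basis (Reg a b)) ℂ :=
  Matrix.of fun f g =>
    if (∀ i : Fin a, f (Sum.inl i) = false) ∧ (∀ i : Fin a, g (Sum.inl i) = false) then
      ρ (f ∘ Sum.inr) (g ∘ Sum.inr)
    else 0

/-- The projection onto the states whose output qubit, the first private qubit, is `|1⟩`. -/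
def acceptProj (a b : ℕ) : Matrix (Basis (Reg a b)) (Basis (Reg a b)) ℂ :=
  Matrix.diagonal fun f => if ∃ i : Fin a, i.val = 0 ∧ f (Sum.inl i) = true then 1 else 0

/-- The probability that a verifier that performs `U` accepts with the witness `ρ`. -/
def acceptProb {a b : ℕ} (U : Unitary (Reg a b))
    (ρ : Matrix (Basis (Fin b)) (Basis (Fin b)) ℂ) : ℝ :=
  (Matrix.trace (acceptProj a b * (U.1 * initialState a ρ * U.1ᴴ))).re

/-- The class of promise problems that have `(lV, lM)`-space-bounded unitary QMA systems in the
model `𝓜` with completeness `c` and soundness `s`. -/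
def QMAUSPACE (𝓜 : UnitaryModel) (lV lM : ℕ → ℕ) (c s : ℕ → ℝ) : Set PromiseProblem :=
  {A | ∃ V ∈ 𝓜.verifiers lV lM, ∀ x : List Bool,
    (x ∈ A.yes → ∃ ρ, IsState ρ ∧ c x.length ≤ acceptProb (V x) ρ) ∧
    (x ∈ A.no → ∀ ρ, IsState ρ → acceptProb (V x) ρ ≤ s x.length)}

/-! ### A concrete model: circuits generated in small space

For each input length `n`, a finite control with at most `(n + 1) * 2 ^ O(lV + lM)` configurations
(as many as a machine with workspace `O(lV + lM)` and a head on the input has) reads the input and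
generates the successive gates of a quantum circuit. The control may depend on `n` in any way, so
that it can use any predetermined functions of the input length. -/

/-- A configuration either outputs a gate, or reads an input bit and moves on accordingly. -/
inductive Instr (Q κ : Type) : Type
  | output (g : Gate κ) : Instr Q κ
  | read (i : ℕ) (next : Bool → Q) : Instr Q κ

/-- A generator of circuits: it is started in each of the configurations `starts` in turn, and
outputs one gate each time. -/
structure Generator (κ : Type) where
  Q : Type
  fin : Fintype Q
  instr : Q → Instr Q κ
  starts : List Q

/-- On input `x`, the generator outputs the gate `g` when started in the configuration `q`. -/
inductive Generator.Outputs {κ : Type} (G : Generator κ) (x : List Bool) : G.Q → Gate κ → Prop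
  | output {q : G.Q} {g : Gate κ} (h : G.instr q = .output g) : G.Outputs x q g
  | read {q : G.Q} {i : ℕ} {f : Bool → G.Q} {g : Gate κ}
      (h : G.instr q = .read i f) (h' : G.Outputs x (f (x.getD i false)) g) : G.Outputs x q g

/-- The families of unitaries performed by circuits that are generated in space `O(lV + lM)`. -/
def generatedFamilies (lV lM : ℕ → ℕ) : Set (Family lV lM) :=
  {V | ∃ (K : ℕ) (G : ∀ n, Generator (Reg (lV n) (lM n))),
    (∀ n, @Fintype.card (G n).Q (G n).fin ≤ (n + 1) * 2 ^ (K * (lV n + lM n + 1))) ∧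
    (∀ n, (G n).starts.length ≤ (n + 1) * 2 ^ (K * (lV n + lM n + 1))) ∧
    ∀ x : List Bool, ∃ gs : List (Gate (Reg (lV x.length) (lM x.length))),
      List.Forall₂ ((G x.length).Outputs x) (G x.length).starts gs ∧ V x = evalCircuit gs}

section Closure

variable {κ μ : Type} [Fintype κ] [DecidableEq κ] [Fintype μ] [DecidableEq μ]

theorem evalCircuit_append (l₁ l₂ : List (Gate κ)) :
    evalCircuit (l₁ ++ l₂) = evalCircuit l₂ * evalCircuit l₁ := by
  induction l₁ with
  | nil => simp [evalCircuit]
  | cons g gs ih => simp [evalCircuit, ih, mul_assoc]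

theorem Gate.eval_mul_self (g : Gate κ) : g.eval * g.eval = 1 := by
  cases g with
  | had i =>
    have : hadamard * hadamard = 1 := Subtype.ext hadamardMatrix_mul_self
    rw [Gate.eval, ← map_mul, this, map_one]
  | cnot k e =>
    have : controlledNot k.val * controlledNot k.val = 1 :=
      Subtype.ext (controlledNotMatrix_mul_self k.val)
    rw [Gate.eval, ← map_mul, this, map_one]

theorem evalCircuit_reverse (l : List (Gate κ)) :
    evalCircuit l.reverse = (evalCircuit l)⁻¹ := by
  induction l with
  | nil => simp [evalCircuit]
  | cons g gs ih =>
    have h1 : evalCircuit [g] = g.eval := one_mul _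
    have h2 : evalCircuit (g :: gs) = evalCircuit gs * g.eval := rfl
    rw [List.reverse_cons, evalCircuit_append, ih, h1, h2, mul_inv_rev,
      inv_eq_of_mul_eq_one_left g.eval_mul_self]

/-- A gate, placed on the qubits selected by `e`. -/
def Gate.map (e : κ ↪ μ) : Gate κ → Gate μ
  | .had i => .had (e i)
  | .cnot k w => .cnot k (w.trans e)

theorem Gate.eval_map (e : κ ↪ μ) (g : Gate κ) : (g.map e).eval = lift e g.eval := by
  cases g with
  | had i =>
    rw [Gate.eval, lift_lift]
    rfl
  | cnot k w =>
    rw [Gate.eval, lift_lift]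
    rfl

theorem evalCircuit_map (e : κ ↪ μ) (l : List (Gate κ)) :
    evalCircuit (l.map (Gate.map e)) = lift e (evalCircuit l) := by
  induction l with
  | nil => simp [evalCircuit]
  | cons g gs ih => rw [List.map_cons, evalCircuit, ih, Gate.eval_map, evalCircuit, map_mul]

end Closure

/-- The generator that runs a fixed sequence of steps, with the circuit of `G` as subroutine. -/
def Generator.compose {a b : ℕ} (G : Generator (Reg a b)) (d : ℕ) (P : List (Step a d b)) :
    Generator (Reg (a + d) b) where
  Q := G.Q ⊕ Fin P.length
  fin := @instFintypeSum _ _ G.fin _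
  instr
    | .inl q =>
      match G.instr q with
      | .output g => .output (g.map (regEmb a d b))
      | .read i f => .read i fun v => .inl (f v)
    | .inr m =>
      match P.get m with
      | .gate g => .output g
      | _ => .read 0 fun _ => .inr m
  starts := (List.finRange P.length).flatMap fun m =>
    match P.get m with
    | .gate _ => [.inr m]
    | .call => G.starts.map .inl
    | .callInv => G.starts.reverse.map .inl

theorem Generator.compose_outputs {a b : ℕ} (G : Generator (Reg a b)) (d : ℕ)
    (P : List (Step a d b)) (x : List Bool) {q : G.Q} {g : Gate (Reg a b)}
    (h : G.Outputs x q g) :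
    (G.compose d P).Outputs x (Sum.inl q) (g.map (regEmb a d b)) := by
  induction h with
  | output h => exact .output (by simp [Generator.compose, h])
  | @read q i f g h _ ih =>
    exact .read (i := i) (f := fun v => Sum.inl (f v)) (by simp [Generator.compose, h]) ih

theorem Generator.compose_run {a b : ℕ} (G : Generator (Reg a b)) (d : ℕ)
    (P : List (Step a d b)) (x : List Bool) (gs : List (Gate (Reg a b)))
    (h : List.Forall₂ (G.Outputs x) G.starts gs) :
    ∃ gs', List.Forall₂ ((G.compose d P).Outputs x) (G.compose d P).starts gs' ∧
      evalSteps (evalCircuit gs) P = evalCircuit gs' := by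
  have key : ∀ L : List (Fin P.length), ∃ gs',
      List.Forall₂ ((G.compose d P).Outputs x)
        (L.flatMap fun m =>
          match P.get m with
          | .gate _ => [(Sum.inr m : G.Q ⊕ Fin P.length)]
          | .call => G.starts.map .inl
          | .callInv => G.starts.reverse.map .inl) gs' ∧
      evalSteps (evalCircuit gs) (L.map P.get) = evalCircuit gs' := by
    intro L
    induction L with
    | nil => exact ⟨[], by simp, rfl⟩
    | cons m L ih =>
      obtain ⟨gs₁, h₁, e₁⟩ := ih
      have step : ∃ gs₀, List.Forall₂ ((G.compose d P).Outputs x)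
          (match P.get m with
          | .gate _ => [(Sum.inr m : G.Q ⊕ Fin P.length)]
          | .call => G.starts.map .inl
          | .callInv => G.starts.reverse.map .inl) gs₀ ∧
          (P.get m).eval (evalCircuit gs) = evalCircuit gs₀ := by
        have hmap : ∀ {l : List G.Q} {r : List (Gate (Reg a b))},
            List.Forall₂ (G.Outputs x) l r →
            List.Forall₂ ((G.compose d P).Outputs x)
              (l.map (Sum.inl : G.Q → G.Q ⊕ Fin P.length))
              (r.map (Gate.map (regEmb a d b))) := by
          intro l r hlr
          induction hlr with
          | nil => exact .nil
          | cons hq _ ih => exact .cons (G.compose_outputs d P x hq) ih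
        rcases hm : P.get m with g | _ | _
        · refine ⟨[g], .cons (.output ?_) .nil, ?_⟩
          · simp only [Generator.compose, hm]
          · simp [evalCircuit, Step.eval]
        · exact ⟨_, hmap h, (evalCircuit_map _ _).symm⟩
        · refine ⟨_, hmap (List.rel_reverse h), ?_⟩
          rw [evalCircuit_map, evalCircuit_reverse]
          rfl
      obtain ⟨gs₀, h₀, e₀⟩ := step
      refine ⟨gs₀ ++ gs₁, ?_, ?_⟩
      · rw [List.flatMap_cons]
        exact List.rel_append h₀ h₁
      · rw [List.map_cons, evalSteps, e₁, e₀, evalCircuit_append]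
  obtain ⟨gs', h', e'⟩ := key (List.finRange P.length)
  refine ⟨gs', h', ?_⟩
  rw [← e']
  congr 1
  exact (List.map_get_finRange P).symm

theorem Generator.compose_starts_length {a b : ℕ} (G : Generator (Reg a b)) (d : ℕ)
    (P : List (Step a d b)) :
    (G.compose d P).starts.length ≤ P.length * (G.starts.length + 1) := by
  have key : ∀ L : List (Fin P.length), (L.flatMap fun m =>
      match P.get m with
      | .gate _ => [(Sum.inr m : G.Q ⊕ Fin P.length)]
      | .call => G.starts.map .inl
      | .callInv => G.starts.reverse.map .inl).length ≤ L.length * (G.starts.length + 1) := by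
    intro L
    induction L with
    | nil => simp
    | cons m L ih =>
      rw [List.flatMap_cons, List.length_append, List.length_cons, Nat.succ_mul, Nat.add_comm]
      refine Nat.add_le_add ih ?_
      rcases P.get m with g | _ | _ <;> simp
  have := key (List.finRange P.length)
  rwa [List.length_finRange] at this

/-- The model in which circuits of Hadamard, NOT, CNOT and Toffoli gates are generated in
small space. -/
def generatedModel : UnitaryModel where
  verifiers := generatedFamilies
  subroutine := by
    rintro lV lM V ⟨K, G, hQ, hS, hG⟩ d K' P hP
    have bound : ∀ n, (n + 1) * 2 ^ (K * (lV n + lM n + 1)) * 2 ^ (K' * (lV n + d n + lM n)) * 2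
        ≤ (n + 1) * 2 ^ ((K + K' + 1) * ((lV + d) n + lM n + 1)) := by
      intro n
      rw [mul_assoc, mul_assoc, ← pow_succ, ← pow_add]
      refine Nat.mul_le_mul le_rfl (Nat.pow_le_pow_right (by norm_num) ?_)
      simp only [Pi.add_apply]
      nlinarith [Nat.zero_le (K * d n), Nat.zero_le (K' * 1), Nat.zero_le (lV n + d n + lM n)]
    refine ⟨K + K' + 1, fun n => (G n).compose (d n) (P n), fun n => ?_, fun n => ?_, fun x => ?_⟩
    · refine le_trans ?_ (bound n)
      have h1 := hQ n
      have h2 := hP n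
      have h3 : @Fintype.card ((G n).Q ⊕ Fin (P n).length) (@instFintypeSum _ _ (G n).fin _) =
          @Fintype.card (G n).Q (G n).fin + (P n).length := by
        let := (G n).fin
        rw [Fintype.card_sum, Fintype.card_fin]
      refine h3.trans_le ?_
      have h4 : 1 ≤ (n + 1) * 2 ^ (K * (lV n + lM n + 1)) := Nat.mul_pos n.succ_pos (by positivity)
      have h5 : 1 ≤ 2 ^ (K' * (lV n + d n + lM n)) := Nat.one_le_two_pow
      nlinarith
    · refine le_trans ((G n).compose_starts_length (d n) (P n)) (le_trans ?_ (bound n))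
      have h1 := hS n
      have h2 := hP n
      have h4 : 1 ≤ (n + 1) * 2 ^ (K * (lV n + lM n + 1)) := Nat.mul_pos n.succ_pos (by positivity)
      calc (P n).length * ((G n).starts.length + 1)
          ≤ 2 ^ (K' * (lV n + d n + lM n)) * ((n + 1) * 2 ^ (K * (lV n + lM n + 1)) * 2) :=
            Nat.mul_le_mul h2 (by omega)
        _ = _ := by ring
    · obtain ⟨gs, h, e⟩ := hG x
      obtain ⟨gs', h', e'⟩ := (G x.length).compose_run (d x.length) (P x.length) x gs h
      refine ⟨gs', h', ?_⟩
      change evalSteps (V x) (P x.length) = evalCircuit gs'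
      rw [e, e']

instance : Inhabited UnitaryModel := ⟨generatedModel⟩

end SpaceQMA

end

/-!
The acceptance probability of a verifier `U` with witness `ρ` is `tr (M ρ)` for an operator
`0 ≤ M ≤ 1` on the witness register, `M = P† U† Π U P`, where `Π` is the acceptance projection and
`P` adds private qubits in the state `0`. Two constructions act on `M`. Negating the output turns
`M` into `1 - M` (`acceptOp_not`). Running `U`, copying the output to a fresh qubit, undoing `U`, and
accepting if the copy is `1` and all the private qubits of `U` are `0` again turns `M` into `M²`
(`acceptOp_squareLayer`). Each use of the second one needs three more private qubits. Together they
give layers that replace every eigenvalue `x` of `M` by `x²` or by `1 - (1 - x)²`, and keep the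
eigenvectors (`exists_acceptOp_amplify`), as if two independent trials were combined by `and` or
by `or`.

Layers are nested, each calling the previous one and its inverse, and `and` or `or` is chosen in
advance from `c` and `s`. Suitable pairs of layers multiply the gap `c - s` by at least `81 / 80`
while it is at most `15 / 16` (`exists_gap_growth`), so that logarithmically many layers in
`1 / (c - s)` make it larger than that. From then on an `and` layer followed by an `or` layer turns
errors `ε` into at most `4 ε²` (`exists_sharpening`), so that logarithmically many layers in `p` make
both errors at most `2⁻ᵖ`. When `p / (c - s) < 2`, no layer is needed (`exists_layers`).

The test whether all the private qubits are `0` is a NOT with many controls. There are too few new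
qubits to store intermediate results for it; instead one qubit in an arbitrary state is borrowed, at
the price of exponentially many gates (`multiNot`), which the model allows.
-/

noncomputable section

namespace SpaceQMA

open scoped ComplexOrder Matrix

/-! ### Adaptive iteration of `x ↦ x²` and `x ↦ 1 - (1 - x)²` -/

/-- The effect of one amplification layer on an acceptance probability: both of two independent
trials accept (`false`), or at least one of them does (`true`). -/
def layer (m : Bool) (x : ℝ) : ℝ := if m then 1 - (1 - x) ^ 2 else x ^ 2

/-- Successive layers; the head of the list is the outermost one, which acts last. -/
def runLayers : List Bool → ℝ → ℝ
  | [], x => x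
  | m :: ms, x => layer m (runLayers ms x)

theorem runLayers_append (l₁ l₂ : List Bool) (x : ℝ) :
    runLayers (l₁ ++ l₂) x = runLayers l₁ (runLayers l₂ x) := by
  induction l₁ with
  | nil => rfl
  | cons m ms ih => rw [List.cons_append, runLayers, ih, runLayers]

theorem layer_mem {m : Bool} {x : ℝ} (hx : x ∈ Set.Icc (0 : ℝ) 1) :
    layer m x ∈ Set.Icc (0 : ℝ) 1 := by
  obtain ⟨h0, h1⟩ := hx
  cases m <;> simp only [layer, Set.mem_Icc, if_true, if_false, Bool.false_eq_true] <;>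
    constructor <;> nlinarith

theorem layer_mono {m : Bool} {x y : ℝ} (hx : 0 ≤ x) (hy : y ≤ 1) (hxy : x ≤ y) :
    layer m x ≤ layer m y := by
  cases m <;> simp only [layer, if_true, if_false, Bool.false_eq_true] <;> nlinarith

theorem runLayers_mem (ms : List Bool) {x : ℝ} (hx : x ∈ Set.Icc (0 : ℝ) 1) :
    runLayers ms x ∈ Set.Icc (0 : ℝ) 1 := by
  induction ms with
  | nil => exact hx
  | cons m ms ih => exact layer_mem ih

theorem runLayers_mono (ms : List Bool) {x y : ℝ} (hx : 0 ≤ x) (hy : y ≤ 1) (hxy : x ≤ y) :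
    runLayers ms x ≤ runLayers ms y := by
  induction ms with
  | nil => exact hxy
  | cons m ms ih =>
    exact layer_mono (runLayers_mem ms ⟨hx, hxy.trans hy⟩).1
      (runLayers_mem ms ⟨hx.trans hxy, hy⟩).2 ih

theorem gap_growth_upper {s c : ℝ} (hs : 0 ≤ s) (hc : c ≤ 1) (h : s < c)
    (hg : c - s ≤ 15 / 16) (hu : 1 ≤ c + s) :
    81 / 80 * (c - s) ≤ (c ^ 2) ^ 2 - (s ^ 2) ^ 2 ∨
      81 / 80 * (c - s) ≤ (1 - (1 - c ^ 2) ^ 2) - (1 - (1 - s ^ 2) ^ 2) := by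
  have key : 81 / 80 ≤ (c + s) * (c ^ 2 + s ^ 2) ∨
      81 / 80 ≤ (c + s) * (2 - (c ^ 2 + s ^ 2)) := by
    by_contra! hh
    obtain ⟨h1, h2⟩ := hh
    have : c + s < 81 / 80 := by linarith
    nlinarith
  rcases key with k | k
  · left; nlinarith
  · right; nlinarith

/-- A layer multiplies the gap `c - s` by `c + s` or by `2 - c - s`, of which one is at least `1`.
Near `c + s = 1`, where the first layer gains little, it moves the pair off centre, and the
second layer gains. -/
theorem exists_gap_growth {s c : ℝ} (hs : 0 ≤ s) (hc : c ≤ 1) (h : s < c)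
    (hg : c - s ≤ 15 / 16) :
    ∃ ms : List Bool, ms.length = 2 ∧
      81 / 80 * (c - s) ≤ runLayers ms c - runLayers ms s := by
  rcases le_total 1 (c + s) with hu | hu
  · rcases gap_growth_upper hs hc h hg hu with k | k
    · exact ⟨[false, false], rfl, by simpa [runLayers, layer] using k⟩
    · exact ⟨[true, false], rfl, by simpa [runLayers, layer] using k⟩
  -- The other half is symmetric under `x ↦ 1 - x`.
  · rcases gap_growth_upper (s := 1 - c) (c := 1 - s) (by linarith) (by linarith) (by linarith)
      (by linarith) (by linarith) with k | k
    · refine ⟨[true, true], rfl, ?_⟩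
      simp only [runLayers, layer, if_true]
      linarith
    · refine ⟨[false, true], rfl, ?_⟩
      simp only [runLayers, layer, if_true, if_false, Bool.false_eq_true]
      linarith

theorem exists_large_gap (N : ℕ) : ∀ {s c : ℝ}, 0 ≤ s → c ≤ 1 → s < c →
    1 ≤ (c - s) * (81 / 80) ^ N →
    ∃ ms : List Bool, ms.length ≤ 2 * N ∧ 15 / 16 < runLayers ms c - runLayers ms s := by
  induction N with
  | zero =>
    intro s c hs hc h hN
    exact ⟨[], le_rfl, by simp only [runLayers]; linarith⟩
  | succ N ih =>
    intro s c hs hc h hN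
    by_cases hg : 15 / 16 < c - s
    · exact ⟨[], by simp, hg⟩
    obtain ⟨ms, hl, hms⟩ := exists_gap_growth hs hc h (not_lt.1 hg)
    have hS := runLayers_mem ms (x := s) ⟨hs, h.le.trans hc⟩
    have hC := runLayers_mem ms (x := c) ⟨hs.trans h.le, hc⟩
    obtain ⟨ms', hl', hms'⟩ := ih hS.1 hC.2 (by linarith) (by
      calc 1 ≤ (c - s) * (81 / 80) ^ (N + 1) := hN
        _ = (81 / 80 * (c - s)) * (81 / 80) ^ N := by ring
        _ ≤ _ := mul_le_mul_of_nonneg_right hms (by positivity))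
    refine ⟨ms' ++ ms, ?_, ?_⟩
    · rw [List.length_append]
      omega
    · rwa [runLayers_append, runLayers_append]

/-- An `and` layer followed by an `or` layer turns both errors `ε` into at most `4 ε²`. -/
theorem exists_sharpening (j : ℕ) {s c ε : ℝ} (hs : 0 ≤ s) (hc : c ≤ 1) (hsε : s ≤ ε)
    (hcε : 1 - c ≤ ε) (hε : 4 * ε ≤ 1) :
    ∃ ms : List Bool, ms.length = 2 * j ∧ 4 * runLayers ms s ≤ (4 * ε) ^ 2 ^ j ∧
      4 * (1 - runLayers ms c) ≤ (4 * ε) ^ 2 ^ j := by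
  have hsm : s ∈ Set.Icc (0 : ℝ) 1 := ⟨hs, by linarith⟩
  have hcm : c ∈ Set.Icc (0 : ℝ) 1 := ⟨by linarith, hc⟩
  induction j with
  | zero => exact ⟨[], rfl, by simpa [runLayers] using hsε, by simpa [runLayers] using hcε⟩
  | succ j ih =>
    obtain ⟨ms, hl, h1, h2⟩ := ih
    refine ⟨true :: false :: ms, by simp [hl]; ring, ?_, ?_⟩
    · simp only [runLayers, layer, if_true, if_false, Bool.false_eq_true]
      rw [pow_succ 2 j, pow_mul]
      have hx := runLayers_mem ms hsm
      have := pow_le_pow_left₀ (by linarith [hx.1]) h1 2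
      nlinarith [sq_nonneg (runLayers ms s ^ 2), sq_nonneg (runLayers ms s)]
    · simp only [runLayers, layer, if_true, if_false, Bool.false_eq_true]
      rw [pow_succ 2 j, pow_mul]
      have hx := runLayers_mem ms hcm
      have := pow_le_pow_left₀ (by linarith [hx.2]) h2 2
      have h3 : (1 - runLayers ms c ^ 2) ≤ 2 * (1 - runLayers ms c) := by
        nlinarith [hx.1, hx.2]
      have h4 := pow_le_pow_left₀ (by nlinarith [hx.1, hx.2]) h3 2
      nlinarith

/-- Logarithmically many layers separate the acceptance probabilities `c` and `s`. No layer is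
spent when `p = 1` and `1 / 2 ≤ c - s`, where the logarithm may be less than any constant. -/
theorem exists_layers {p : ℕ} {s c : ℝ} (hp : 1 ≤ p) (hs : 0 ≤ s) (hc : c ≤ 1) (h : s < c) :
    ∃ ms : List Bool, ((3 * ms.length : ℕ) : ℝ) ≤ 684 * Real.logb 2 (p / (c - s)) ∧
      1 - (2 : ℝ)⁻¹ ^ p ≤ runLayers ms c ∧ runLayers ms s ≤ (2 : ℝ)⁻¹ ^ p := by
  have hg : 0 < c - s := sub_pos.2 h
  have hp' : (1 : ℝ) ≤ p := by exact_mod_cast hp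
  by_cases htriv : p = 1 ∧ 1 / 2 ≤ c - s
  · obtain ⟨rfl, h2⟩ := htriv
    refine ⟨[], ?_, ?_, ?_⟩
    · have : 0 ≤ Real.logb 2 (((1 : ℕ) : ℝ) / (c - s)) :=
        Real.logb_nonneg (by norm_num) (by rw [le_div_iff₀ hg]; push_cast; linarith)
      rw [List.length_nil, mul_zero, Nat.cast_zero]
      positivity
    · simp only [runLayers, pow_one]; linarith
    · simp only [runLayers, pow_one]; linarith
  have hX : 2 ≤ (p : ℝ) / (c - s) := by
    rw [le_div_iff₀ hg]
    rcases Nat.lt_or_ge p 2 with h2 | h2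
    · have h1 : p = 1 := by omega
      have : c - s < 1 / 2 := not_le.1 fun h' => htriv ⟨h1, h'⟩
      linarith
    · have : (2 : ℝ) ≤ p := by exact_mod_cast h2
      linarith
  set X : ℝ := p / (c - s) with hXdef
  have hlog : 1 ≤ Real.logb 2 X := by
    rw [Real.le_logb_iff_rpow_le (by norm_num) (by linarith)]
    simpa using hX
  obtain ⟨k, hk1, hk2⟩ : ∃ k : ℕ, X ≤ 2 ^ k ∧ (k : ℝ) ≤ 2 * Real.logb 2 X := by
    refine ⟨⌈Real.logb 2 X⌉₊, ?_, ?_⟩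
    · rw [← Real.rpow_natCast, ← Real.logb_le_iff_le_rpow (by norm_num) (by linarith)]
      exact Nat.le_ceil _
    · linarith [Nat.ceil_lt_add_one (show 0 ≤ Real.logb 2 X by linarith)]
  have hpX : (p : ℝ) ≤ X := by
    rw [hXdef, le_div_iff₀ hg]
    nlinarith
  have hgX : 1 ≤ (c - s) * 2 ^ k := by
    have : (p : ℝ) = (c - s) * X := by rw [hXdef]; field_simp
    nlinarith
  -- `2 * 56 * k` layers for the gap and `2 * k` for the errors, three qubits each, and
  -- `k ≤ 2 * logb 2 X`, make `684 = 3 * 114 * 2`.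
  have h56 : (2 : ℝ) ^ k ≤ (81 / 80) ^ (56 * k) := by
    rw [pow_mul]
    exact pow_le_pow_left₀ (by norm_num) (by norm_num) k
  obtain ⟨ms, hl, hms⟩ := exists_large_gap (56 * k) hs hc h
    (hgX.trans (mul_le_mul_of_nonneg_left h56 hg.le))
  have hS := runLayers_mem ms (x := s) ⟨hs, h.le.trans hc⟩
  have hC := runLayers_mem ms (x := c) ⟨hs.trans h.le, hc⟩
  obtain ⟨ms', hl', h1, h2⟩ := exists_sharpening k (ε := 1 / 16) hS.1 hC.2
    (by linarith [hC.2]) (by linarith [hS.1]) (by norm_num)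
  have hpk : p ≤ 2 ^ k := by exact_mod_cast hpX.trans hk1
  have hfin : (4 * (1 / 16) : ℝ) ^ 2 ^ k ≤ (2 : ℝ)⁻¹ ^ p :=
    calc (4 * (1 / 16) : ℝ) ^ 2 ^ k ≤ (2 : ℝ)⁻¹ ^ 2 ^ k :=
          pow_le_pow_left₀ (by norm_num) (by norm_num) _
      _ ≤ (2 : ℝ)⁻¹ ^ p := pow_le_pow_of_le_one (by norm_num) (by norm_num) hpk
  refine ⟨ms' ++ ms, ?_, ?_, ?_⟩
  · have : 3 * (ms' ++ ms).length ≤ 342 * k := by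
      rw [List.length_append]
      omega
    have : ((3 * (ms' ++ ms).length : ℕ) : ℝ) ≤ 342 * k := by exact_mod_cast this
    linarith
  · rw [runLayers_append]
    linarith [(runLayers_mem ms' hC).2]
  · rw [runLayers_append]
    linarith [(runLayers_mem ms' hS).1]

/-! ### Matrices of functions on basis states -/

section FnMatrix

variable {α β γ : Type}

open Classical in
/-- The linear map that sends each basis state `x` to the basis state `φ x`. -/
def fnMatrix (φ : α → β) : Matrix β α ℂ := Matrix.of fun y x => if y = φ x then 1 else 0

open Classical in
/-- The projection onto the span of the basis states that satisfy `q`. -/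
def basisProj (q : α → Prop) : Matrix α α ℂ := Matrix.diagonal fun x => if q x then 1 else 0

theorem mul_fnMatrix_apply [Fintype β] (φ : α → β) (A : Matrix γ β ℂ) (z : γ) (x : α) :
    (A * fnMatrix φ) z x = A z (φ x) := by
  classical
  simp [Matrix.mul_apply, fnMatrix, mul_ite]

theorem fnMatrix_comp [Fintype β] (φ : α → β) (ψ : β → γ) :
    fnMatrix ψ * fnMatrix φ = fnMatrix (ψ ∘ φ) := by
  ext z x
  rw [mul_fnMatrix_apply]
  rfl

theorem fnMatrix_id [DecidableEq α] : fnMatrix (id : α → α) = 1 := by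
  ext x y
  simp [fnMatrix, Matrix.one_apply]

theorem conjTranspose_fnMatrix_mul_self [Fintype β] [DecidableEq α] {φ : α → β}
    (hφ : Function.Injective φ) : (fnMatrix φ)ᴴ * fnMatrix φ = 1 := by
  ext x y
  rw [mul_fnMatrix_apply, Matrix.conjTranspose_apply, Matrix.one_apply]
  simp only [fnMatrix, Matrix.of_apply, hφ.eq_iff, eq_comm (a := x)]
  split_ifs <;> simp

theorem conjTranspose_fnMatrix_mul_of_ne [Fintype β] {φ ψ : α → β} (h : ∀ x y, φ x ≠ ψ y) :
    (fnMatrix φ)ᴴ * fnMatrix ψ = 0 := by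
  ext x y
  rw [mul_fnMatrix_apply, Matrix.conjTranspose_apply]
  simp [fnMatrix, (h x y).symm]

theorem basisProj_mul_fnMatrix [Fintype α] [Fintype β] [DecidableEq β] (q : β → Prop)
    (φ : α → β) : basisProj q * fnMatrix φ = fnMatrix φ * basisProj (q ∘ φ) := by
  classical
  ext y x
  rw [mul_fnMatrix_apply]
  simp only [basisProj, Matrix.diagonal_apply]
  rw [Matrix.mul_diagonal]
  by_cases h : y = φ x
  · subst h; simp [fnMatrix]
  · simp [fnMatrix, h]

theorem basisProj_congr {q r : α → Prop} (h : ∀ x, q x ↔ r x) : basisProj q = basisProj r := by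
  rw [funext fun x => propext (h x)]

theorem basisProj_false {q : α → Prop} (h : ∀ x, ¬ q x) : basisProj q = 0 := by
  ext x y
  simp [basisProj, Matrix.diagonal_apply, h]

theorem basisProj_not [DecidableEq α] (q : α → Prop) :
    basisProj (fun x => ¬ q x) = 1 - basisProj q := by
  ext x y
  by_cases h : x = y
  · subst h
    by_cases hq : q x <;> simp [basisProj, hq]
  · simp [basisProj, h]

theorem posSemidef_basisProj (q : α → Prop) : (basisProj q).PosSemidef := by
  classical
  refine Matrix.PosSemidef.diagonal fun x => ?_
  by_cases h : q x <;> simp [h]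

/-- A basis function that is given by cases splits accordingly. -/
theorem fnMatrix_ite [Fintype α] [DecidableEq α] (q : α → Prop) (φ ψ χ : α → β)
    (h1 : ∀ x, q x → χ x = φ x) (h0 : ∀ x, ¬ q x → χ x = ψ x) :
    fnMatrix χ = fnMatrix φ * basisProj q + fnMatrix ψ * (1 - basisProj q) := by
  classical
  rw [← basisProj_not]
  ext y x
  simp only [Matrix.add_apply, basisProj, Matrix.mul_diagonal]
  by_cases hq : q x
  · simp [hq, fnMatrix, h1 x hq]
  · simp [hq, fnMatrix, h0 x hq]

end FnMatrix

/-! ### Classical reversible circuits -/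

section Classical

variable {κ : Type} [DecidableEq κ]

/-- The NOT of the qubit `t`. -/
def notGate (t : κ) : Gate κ := .cnot 0 ⟨fun _ => t, fun _ _ _ => Subsingleton.elim (α := Fin 1) _ _⟩

/-- The NOT of the qubit `t` controlled by the qubit `b`; no gate unless `b ≠ t`. -/
def cnotGate (b t : κ) : List (Gate κ) :=
  if h : t ≠ b then
    [.cnot 1 ⟨(![t, b] : Fin 2 → κ), by
      intro i j; fin_cases i <;> fin_cases j <;> simp [h, h.symm]⟩]
  else []

/-- The NOT of the qubit `t` controlled by `b` and `a`; no gate unless the three are distinct. -/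
def toffoli (b a t : κ) : List (Gate κ) :=
  if h : t ≠ b ∧ t ≠ a ∧ b ≠ a then
    [.cnot 2 ⟨(![t, b, a] : Fin 3 → κ), by
      intro i j
      fin_cases i <;> fin_cases j <;> simp [h.1, h.2.1, h.2.2, h.1.symm, h.2.1.symm, h.2.2.symm]⟩]
  else []

/-- The NOT of `t` controlled by all the qubits in `cs`, with the help of one qubit `d` whose
state is arbitrary and is restored. The qubits `t` and `d` exchange their roles in the recursion.
The circuit has exponential size, but needs no clean qubit. -/
def multiNot : List κ → κ → κ → List (Gate κ)
  | [], t, _ => [notGate t]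
  | b :: cs, t, d => toffoli b d t ++ (multiNot cs d t ++ (toffoli b d t ++ multiNot cs d t))

theorem length_toffoli (b a t : κ) : (toffoli b a t).length ≤ 1 := by
  unfold toffoli
  split_ifs <;> simp

theorem length_cnotGate (b t : κ) : (cnotGate b t).length ≤ 1 := by
  unfold cnotGate
  split_ifs <;> simp

theorem length_multiNot (cs : List κ) (t d : κ) :
    (multiNot cs t d).length + 2 ≤ 3 * 2 ^ cs.length := by
  induction cs generalizing t d with
  | nil => simp [multiNot]
  | cons b cs ih =>
    have h1 := length_toffoli b d t
    have h2 := ih d t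
    simp only [multiNot, List.length_append, List.length_cons, pow_succ]
    omega

variable [Fintype κ]

/-- The circuit `l` permutes the basis states by `φ`. -/
def Computes (l : List (Gate κ)) (φ : Basis κ → Basis κ) : Prop :=
  (evalCircuit l).1 = fnMatrix φ

theorem computes_nil : Computes ([] : List (Gate κ)) id := by
  simp [Computes, evalCircuit, fnMatrix_id]

theorem Computes.append {l₁ l₂ : List (Gate κ)} {φ ψ : Basis κ → Basis κ} (h₁ : Computes l₁ φ)
    (h₂ : Computes l₂ ψ) : Computes (l₁ ++ l₂) (ψ ∘ φ) := by
  unfold Computes at *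
  rw [evalCircuit_append, Submonoid.coe_mul, h₁, h₂, fnMatrix_comp]

theorem computes_cnot (k : Fin 3) (e : Fin (k.val + 1) ↪ κ) :
    Computes [Gate.cnot k e] fun f =>
      if ∀ i : Fin k.val, f (e i.succ) = true then Function.update f (e 0) (!f (e 0)) else f := by
  classical
  have h : (evalCircuit [Gate.cnot k e]).1 = liftMatrix e (controlledNotMatrix k.val) := by
    simp [evalCircuit, Gate.eval, lift, controlledNot]
  rw [Computes, h]
  ext f g
  simp only [liftMatrix, controlledNotMatrix, fnMatrix, Matrix.of_apply, ← ite_and, flipTarget,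
    Function.comp_apply]
  congr 1
  rw [eq_iff_iff]
  split_ifs with hc
  · constructor
    · rintro ⟨h1, h2⟩
      funext x
      by_cases hx : x ∈ Set.range e
      · obtain ⟨i, rfl⟩ := hx
        have := congrFun h2 i
        simp only [Function.comp_apply] at this
        rw [this]
        simp [Function.update_apply, e.injective.eq_iff]
      · rw [h1 x hx, Function.update_of_ne]
        rintro rfl
        exact hx ⟨0, rfl⟩
    · rintro rfl
      refine ⟨fun x hx => Function.update_of_ne ?_ _ _, ?_⟩
      · rintro rfl
        exact hx ⟨0, rfl⟩
      · funext i
        simp [Function.update_apply, e.injective.eq_iff]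
  · constructor
    · rintro ⟨h1, h2⟩
      funext x
      by_cases hx : x ∈ Set.range e
      · obtain ⟨i, rfl⟩ := hx
        exact congrFun h2 i
      · exact h1 x hx
    · rintro rfl
      simp

theorem computes_not (t : κ) : Computes [notGate t] fun f => Function.update f t (!f t) := by
  have := computes_cnot (0 : Fin 3)
    ⟨fun _ => t, fun _ _ _ => Subsingleton.elim (α := Fin 1) _ _⟩
  simpa [notGate] using this

theorem computes_cnotGate {b t : κ} (h : t ≠ b) :
    Computes (cnotGate b t) fun f => Function.update f t (f t ^^ f b) := by
  rw [cnotGate, dif_pos h]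
  have := computes_cnot (1 : Fin 3) (⟨(![t, b] : Fin 2 → κ), by
      intro i j; fin_cases i <;> fin_cases j <;> simp [h, h.symm]⟩)
  convert this using 1
  funext f
  have hall : (∀ i : Fin 1, f ((![t, b] : Fin 2 → κ) i.succ) = true) ↔ f b = true := by simp
  change _ = if (∀ i : Fin 1, f ((![t, b] : Fin 2 → κ) i.succ) = true) then
    Function.update f t (!f t) else f
  simp only [hall]
  cases hb : f b <;> simp

theorem computes_toffoli {b a t : κ} (h1 : t ≠ b) (h2 : t ≠ a) (h3 : b ≠ a) :
    Computes (toffoli b a t) fun f => Function.update f t (f t ^^ (f b && f a)) := by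
  rw [toffoli, dif_pos ⟨h1, h2, h3⟩]
  have := computes_cnot (2 : Fin 3) (⟨(![t, b, a] : Fin 3 → κ), by
      intro i j
      fin_cases i <;> fin_cases j <;> simp [h1, h2, h3, h1.symm, h2.symm, h3.symm]⟩)
  convert this using 1
  funext f
  have hall : (∀ i : Fin 2, f ((![t, b, a] : Fin 3 → κ) i.succ) = true) ↔
      (f b && f a) = true := by simp [Fin.forall_fin_two]
  change _ = if (∀ i : Fin 2, f ((![t, b, a] : Fin 3 → κ) i.succ) = true) then
    Function.update f t (!f t) else f
  simp only [hall]
  cases f b && f a <;> simp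

theorem computes_multiNot (cs : List κ) {t d : κ} (hd : t ≠ d) (ht : t ∉ cs) (hdc : d ∉ cs) :
    Computes (multiNot cs t d) fun f =>
      Function.update f t (f t ^^ cs.all f) := by
  induction cs generalizing t d with
  | nil => simpa [multiNot] using computes_not t
  | cons b cs ih =>
    simp only [List.mem_cons, not_or] at ht hdc
    have h1 := computes_toffoli ht.1 hd (Ne.symm hdc.1)
    have h2 := ih hd.symm hdc.2 ht.2
    have h := h1.append (h2.append (h1.append h2))
    rw [multiNot]
    convert h using 1
    funext f
    have hall : ∀ (g : Basis κ) (r : κ) (v : Bool), r ∉ cs →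
        cs.all (Function.update g r v) = cs.all g := by
      intro g r v hr
      rw [Bool.eq_iff_iff]
      simp only [List.all_eq_true]
      refine forall₂_congr fun x hx => ?_
      rw [Function.update_of_ne]
      rintro rfl
      exact hr hx
    funext x
    simp only [Function.comp_apply, hall _ _ _ ht.2, hall _ _ _ hdc.2]
    have hbt := Ne.symm ht.1
    have hbd := Ne.symm hdc.1
    by_cases hxt : x = t
    · subst hxt
      simp only [Function.update_self, Function.update_of_ne hd, Function.update_of_ne hd.symm,
        Function.update_of_ne hbt, Function.update_of_ne hbd, List.all_cons]
      cases f x <;> cases f b <;> cases f d <;> cases cs.all f <;> rfl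
    · by_cases hxd : x = d
      · subst hxd
        simp only [Function.update_self, Function.update_of_ne hd, Function.update_of_ne hd.symm,
          Function.update_of_ne hbt, Function.update_of_ne hbd, List.all_cons]
        cases f x <;> cases cs.all f <;> rfl
      · simp only [Function.update_of_ne hxt, Function.update_of_ne hxd]

end Classical

/-! ### Acceptance operators -/

/-- The basis state of `(V, M)` with private qubits `0` and witness qubits `h`. -/
def pad (a : ℕ) {b : ℕ} (h : Basis (Fin b)) : Basis (Reg a b) := Sum.elim (fun _ => false) h

/-- The isometry that adds private qubits in the state `0`. -/
abbrev padMatrix (a b : ℕ) : Matrix (Basis (Reg a b)) (Basis (Fin b)) ℂ := fnMatrix (pad a)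

/-- All the private qubits are `0`. -/
def ZeroPrivate {a b : ℕ} (f : Basis (Reg a b)) : Prop := ∀ i : Fin a, f (Sum.inl i) = false

/-- The output qubit is `1`. -/
def Accepts {a b : ℕ} (f : Basis (Reg a b)) : Prop :=
  ∃ i : Fin a, i.val = 0 ∧ f (Sum.inl i) = true

theorem acceptProj_eq (a b : ℕ) : acceptProj a b = basisProj (Accepts : Basis (Reg a b) → Prop) := by
  classical
  ext f g
  simp only [acceptProj, basisProj, Matrix.diagonal_apply, Accepts]
  congr

/-- The operator `M` on the witness register with `acceptProb U ρ = tr (M ρ)`. -/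
def acceptOp {a b : ℕ} (U : Unitary (Reg a b)) : Matrix (Basis (Fin b)) (Basis (Fin b)) ℂ :=
  (padMatrix a b)ᴴ * (U.1ᴴ * (acceptProj a b * (U.1 * padMatrix a b)))

theorem fnMatrix_mul_apply_of_leftInverse {α β γ : Type} [Fintype α] {φ : α → β} {r : β → α}
    (h : Function.LeftInverse r φ) (A : Matrix α γ ℂ) (y : β) (z : γ) [Decidable (y = φ (r y))] :
    (fnMatrix φ * A) y z = if y = φ (r y) then A (r y) z else 0 := by
  classical
  rw [Matrix.mul_apply, Finset.sum_eq_single (r y)]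
  · simp [fnMatrix]
  · intro x _ hx
    have : y ≠ φ x := by
      rintro rfl
      exact hx (h x).symm
    simp [fnMatrix, this]
  · simp

theorem leftInverse_pad (a b : ℕ) :
    Function.LeftInverse (fun f : Basis (Reg a b) => f ∘ Sum.inr) (pad a) := fun _ => rfl

theorem eq_pad_iff {a b : ℕ} (f : Basis (Reg a b)) :
    f = pad a (f ∘ Sum.inr) ↔ ZeroPrivate f := by
  constructor
  · intro h i
    rw [h]
    rfl
  · intro h
    funext x
    rcases x with i | j
    · exact h i
    · rfl

theorem pad_mul_conjTranspose (a b : ℕ) :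
    padMatrix a b * (padMatrix a b)ᴴ = basisProj ZeroPrivate := by
  classical
  ext f g
  rw [fnMatrix_mul_apply_of_leftInverse (leftInverse_pad a b), Matrix.conjTranspose_apply]
  simp only [eq_pad_iff, fnMatrix, basisProj, Matrix.of_apply, Matrix.diagonal_apply]
  by_cases hf : ZeroPrivate f
  · simp only [hf, if_true]
    have : g = pad a (f ∘ Sum.inr) ↔ f = g := by
      rw [← (eq_pad_iff f).2 hf, eq_comm]
    simp only [this]
    split_ifs <;> simp
  · simp [hf]

theorem initialState_eq (a : ℕ) {b : ℕ} (ρ : Matrix (Basis (Fin b)) (Basis (Fin b)) ℂ) :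
    initialState a ρ = padMatrix a b * ρ * (padMatrix a b)ᴴ := by
  classical
  have h : ∀ A : Matrix (Basis (Fin b)) (Basis (Reg a b)) ℂ, ∀ f g,
      (padMatrix a b * A) f g = if ZeroPrivate f then A (f ∘ Sum.inr) g else 0 := by
    intro A f g
    rw [fnMatrix_mul_apply_of_leftInverse (leftInverse_pad a b)]
    simp only [eq_pad_iff]
  have h' : ∀ f g, (ρ * (padMatrix a b)ᴴ) f g =
      if ZeroPrivate g then ρ f (g ∘ Sum.inr) else 0 := by
    intro f g
    have : ρ * (padMatrix a b)ᴴ = (padMatrix a b * ρᴴ)ᴴ := by simp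
    rw [this, Matrix.conjTranspose_apply, fnMatrix_mul_apply_of_leftInverse (leftInverse_pad a b)]
    simp only [eq_pad_iff]
    split_ifs <;> simp
  ext f g
  rw [Matrix.mul_assoc, h, h']
  simp only [initialState, Matrix.of_apply, ZeroPrivate, ite_and]
  congr

theorem acceptProb_eq {a b : ℕ} (U : Unitary (Reg a b))
    (ρ : Matrix (Basis (Fin b)) (Basis (Fin b)) ℂ) :
    acceptProb U ρ = (Matrix.trace (acceptOp U * ρ)).re := by
  rw [acceptProb, acceptOp, initialState_eq]
  congr 1
  have : acceptProj a b * (U.1 * (padMatrix a b * ρ * (padMatrix a b)ᴴ) * U.1ᴴ) =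
      (acceptProj a b * (U.1 * padMatrix a b) * ρ) * ((padMatrix a b)ᴴ * U.1ᴴ) := by
    simp only [Matrix.mul_assoc]
  rw [this, Matrix.trace_mul_comm]
  simp only [Matrix.mul_assoc]

theorem unitary_conjTranspose_mul {κ : Type} [Fintype κ] [DecidableEq κ] (U : Unitary κ) :
    U.1ᴴ * U.1 = 1 := Matrix.mem_unitaryGroup_iff'.1 U.2

theorem unitary_mul_conjTranspose {κ : Type} [Fintype κ] [DecidableEq κ] (U : Unitary κ) :
    U.1 * U.1ᴴ = 1 := Matrix.mem_unitaryGroup_iff.1 U.2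

theorem posSemidef_acceptOp {a b : ℕ} (U : Unitary (Reg a b)) : (acceptOp U).PosSemidef := by
  have := (posSemidef_basisProj (Accepts (a := a) (b := b))).conjTranspose_mul_mul_same
    (U.1 * padMatrix a b)
  rw [← acceptProj_eq] at this
  simpa only [acceptOp, Matrix.mul_assoc, Matrix.conjTranspose_mul] using this

/-- Conjugating a diagonal projection by a permutation of the basis states. -/
theorem Computes.conj_basisProj {κ : Type} [Fintype κ] [DecidableEq κ] {l : List (Gate κ)}
    {φ : Basis κ → Basis κ} (h : Computes l φ) (q : Basis κ → Prop) :
    (evalCircuit l).1ᴴ * (basisProj q * (evalCircuit l).1) = basisProj (q ∘ φ) := by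
  have h' : basisProj q * (evalCircuit l).1 = (evalCircuit l).1 * basisProj (q ∘ φ) := by
    rw [h, basisProj_mul_fnMatrix]
  rw [h', ← Matrix.mul_assoc, unitary_conjTranspose_mul, one_mul]

/-! ### Negation of the output -/

/-- The output qubit. -/
def outQubit {a : ℕ} (b : ℕ) (ha : 0 < a) : Reg a b := Sum.inl ⟨0, ha⟩

theorem accepts_iff {a b : ℕ} (ha : 0 < a) (f : Basis (Reg a b)) :
    Accepts f ↔ f (outQubit b ha) = true := by
  constructor
  · rintro ⟨i, hi, h⟩
    rwa [show i = ⟨0, ha⟩ from Fin.ext hi] at h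
  · exact fun h => ⟨⟨0, ha⟩, rfl, h⟩

theorem acceptOp_not {a b : ℕ} (ha : 0 < a) (U : Unitary (Reg a b)) :
    acceptOp (evalCircuit [notGate (outQubit b ha)] * U) = 1 - acceptOp U := by
  have h1 := (computes_not (outQubit b ha)).conj_basisProj Accepts
  rw [← acceptProj_eq] at h1
  have h2 : basisProj (Accepts ∘ fun f : Basis (Reg a b) =>
      Function.update f (outQubit b ha) (!f (outQubit b ha))) = 1 - acceptProj a b := by
    rw [acceptProj_eq, ← basisProj_not]
    refine basisProj_congr fun f => ?_
    simp [accepts_iff ha]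
  have h3 : (padMatrix a b)ᴴ * padMatrix a b = 1 :=
    conjTranspose_fnMatrix_mul_self (leftInverse_pad a b).injective
  rw [h2] at h1
  have h4 : acceptOp (evalCircuit [notGate (outQubit b ha)] * U) =
      (padMatrix a b)ᴴ * (U.1ᴴ * (((evalCircuit [notGate (outQubit b ha)]).1ᴴ *
        (acceptProj a b * (evalCircuit [notGate (outQubit b ha)]).1)) *
          (U.1 * padMatrix a b))) := by
    simp only [acceptOp, Submonoid.coe_mul, Matrix.conjTranspose_mul, Matrix.mul_assoc]
  rw [h4, h1, Matrix.sub_mul, Matrix.mul_sub, Matrix.mul_sub, Matrix.one_mul,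
    ← Matrix.mul_assoc U.1ᴴ, unitary_conjTranspose_mul, Matrix.one_mul, h3]
  rfl

/-! ### Fresh private qubits -/

/-- The basis state with old qubits `g` and new private qubits `c`. -/
def glue {a d b : ℕ} (c : Basis (Fin d)) (g : Basis (Reg a b)) : Basis (Reg (a + d) b) :=
  Sum.elim (Fin.append (g ∘ Sum.inl) c) (g ∘ Sum.inr)

/-- The isometry that adds new private qubits in the state `c`. -/
abbrev glueMatrix (a b : ℕ) {d : ℕ} (c : Basis (Fin d)) :
    Matrix (Basis (Reg (a + d) b)) (Basis (Reg a b)) ℂ := fnMatrix (glue c)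

/-- A new private qubit. -/
def newQubit (a b : ℕ) {d : ℕ} (i : Fin d) : Reg (a + d) b := Sum.inl (Fin.natAdd a i)

theorem glue_old {a d b : ℕ} (c : Basis (Fin d)) (g : Basis (Reg a b)) (x : Reg a b) :
    glue c g (regEmb a d b x) = g x := by
  rcases x with i | j
  · exact Fin.append_left _ _ i
  · rfl

theorem glue_new {a d b : ℕ} (c : Basis (Fin d)) (g : Basis (Reg a b)) (i : Fin d) :
    glue c g (newQubit a b i) = c i :=
  Fin.append_right _ _ i

theorem leftInverse_glue {a d b : ℕ} (c : Basis (Fin d)) :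
    Function.LeftInverse (fun f => f ∘ regEmb a d b) (glue c) :=
  fun g => funext (glue_old c g)

theorem newQubit_notMem_range {a d b : ℕ} (i : Fin d) :
    newQubit a b i ∉ Set.range (regEmb a d b) := by
  rintro ⟨j | j, h⟩
  · have h' : Fin.castAdd d j = Fin.natAdd a i := Sum.inl.inj h
    have := congrArg Fin.val h'
    simp at this
    omega
  · exact absurd h (by simp [regEmb, newQubit])

theorem mem_range_or_newQubit {a d b : ℕ} (x : Reg (a + d) b) :
    (∃ y, x = regEmb a d b y) ∨ ∃ i, x = newQubit a b i := by
  rcases x with x | j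
  · induction x using Fin.addCases with
    | left i => exact Or.inl ⟨Sum.inl i, rfl⟩
    | right i => exact Or.inr ⟨i, rfl⟩
  · exact Or.inl ⟨Sum.inr j, rfl⟩

theorem eq_glue_iff {a d b : ℕ} (c : Basis (Fin d)) (f : Basis (Reg (a + d) b)) :
    f = glue c (f ∘ regEmb a d b) ↔ ∀ i, f (newQubit a b i) = c i := by
  constructor
  · intro h i
    rw [h, glue_new]
  · intro h
    funext x
    rcases mem_range_or_newQubit x with ⟨y, rfl⟩ | ⟨i, rfl⟩
    · rw [glue_old]
      rfl
    · rw [glue_new, h]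

/-- A unitary of the old qubits does not touch the new ones. -/
theorem lift_mul_glue {a d b : ℕ} (U : Unitary (Reg a b)) (c : Basis (Fin d)) :
    (lift (regEmb a d b) U).1 * glueMatrix a b c = glueMatrix a b c * U.1 := by
  classical
  ext f g
  rw [mul_fnMatrix_apply, fnMatrix_mul_apply_of_leftInverse (leftInverse_glue c)]
  change liftMatrix (regEmb a d b) U.1 f (glue c g) = _
  have h : (∀ k, k ∉ Set.range (regEmb a d b) → f k = glue c g k) ↔
      ∀ i, f (newQubit a b i) = c i := by
    constructor
    · intro h i
      rw [h _ (newQubit_notMem_range i), glue_new]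
    · intro h x hx
      rcases mem_range_or_newQubit x with ⟨y, rfl⟩ | ⟨i, rfl⟩
      · exact absurd ⟨y, rfl⟩ hx
      · rw [h, glue_new]
  have h' : glue c g ∘ regEmb a d b = g := leftInverse_glue c g
  simp only [liftMatrix, Matrix.of_apply, h, h', eq_glue_iff]

theorem lift_regEmb_zero {a b : ℕ} (U : Unitary (Reg a b)) :
    lift (regEmb a 0 b) U = (U : Unitary (Reg (a + 0) b)) := by
  have h := lift_mul_glue (d := 0) U Fin.elim0
  have h' : glue (a := a) (d := 0) (b := b) Fin.elim0 = id := by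
    funext g x
    rcases x with i | j
    · exact Fin.append_left (g ∘ Sum.inl) Fin.elim0 i
    · rfl
  rw [glueMatrix, h'] at h
  apply Subtype.ext
  have h'' : fnMatrix (id : Basis (Reg a b) → Basis (Reg a b)) = 1 := fnMatrix_id
  erw [h'', Matrix.mul_one, Matrix.one_mul] at h
  exact h

/-! ### Squaring the acceptance operator -/

/-- The private qubits that were present before three more were added. -/
def oldPrivate (a b : ℕ) : List (Reg (a + 3) b) :=
  (List.finRange a).map fun i => regEmb a 3 b (Sum.inl i)

/-- The first new qubit holds a copy of the output of the subroutine, the second one receives the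
answer, and the third one is borrowed. The circuit computes into the second one whether the copy
is `1` and the old private qubits are all `0`, and brings this answer into the output qubit. -/
def checkCircuit {a : ℕ} (b : ℕ) (ha : 0 < a) : List (Gate (Reg (a + 3) b)) :=
  let o := outQubit b (Nat.add_pos_left ha 3)
  let t := newQubit a b (1 : Fin 3)
  (oldPrivate a b).map notGate ++
    (multiNot (newQubit a b (0 : Fin 3) :: oldPrivate a b) t (newQubit a b (2 : Fin 3)) ++
      (cnotGate t o ++ (cnotGate o t ++ cnotGate t o)))

theorem length_checkCircuit {a : ℕ} (b : ℕ) (ha : 0 < a) :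
    (checkCircuit b ha).length ≤ a + 3 * 2 ^ (a + 1) + 3 := by
  have h1 := length_multiNot (newQubit a b (0 : Fin 3) :: oldPrivate a b)
    (newQubit a b (1 : Fin 3)) (newQubit a b (2 : Fin 3))
  have h2 := length_cnotGate (newQubit a b (1 : Fin 3)) (outQubit b (Nat.add_pos_left ha 3))
  have h3 := length_cnotGate (outQubit b (Nat.add_pos_left ha 3)) (newQubit a b (1 : Fin 3))
  simp only [checkCircuit, List.length_append, List.length_map, List.length_cons, oldPrivate,
    List.length_finRange] at h1 ⊢
  omega

theorem exists_computes_map_notGate {κ : Type} [Fintype κ] [DecidableEq κ] (l : List κ)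
    (hl : l.Nodup) : ∃ φ : Basis κ → Basis κ, Computes (l.map notGate) φ ∧
      (∀ f, ∀ x ∈ l, φ f x = !f x) ∧ ∀ f, ∀ x ∉ l, φ f x = f x := by
  induction l with
  | nil => exact ⟨id, computes_nil, by simp, by simp⟩
  | cons t l ih =>
    rw [List.nodup_cons] at hl
    obtain ⟨φ, h, hmem, hnot⟩ := ih hl.2
    refine ⟨_, (computes_not t).append h, fun f x hx => ?_, fun f x hx => ?_⟩
    · rw [Function.comp_apply]
      by_cases hxt : x = t
      · rw [hnot _ _ (hxt ▸ hl.1), hxt, Function.update_self]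
      · rw [hmem _ _ ((List.mem_cons.1 hx).resolve_left hxt), Function.update_of_ne hxt]
    · rw [List.mem_cons, not_or] at hx
      rw [Function.comp_apply, hnot _ _ hx.2, Function.update_of_ne hx.1]

theorem nodup_oldPrivate (a b : ℕ) : (oldPrivate a b).Nodup :=
  (List.nodup_finRange a).map ((regEmb a 3 b).injective.comp Sum.inl_injective)

theorem newQubit_notMem_oldPrivate {a b : ℕ} (i : Fin 3) : newQubit a b i ∉ oldPrivate a b := by
  intro h
  obtain ⟨j, -, hj⟩ := List.mem_map.1 h
  exact newQubit_notMem_range i ⟨_, hj⟩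

theorem newQubit_inj {a b d : ℕ} {i j : Fin d} : newQubit a b i = newQubit a b j ↔ i = j := by
  simp [newQubit]

theorem outQubit_eq {a b : ℕ} (ha : 0 < a) :
    outQubit b (Nat.add_pos_left ha 3) = regEmb a 3 b (outQubit b ha) := rfl

theorem newQubit_ne_outQubit {a b : ℕ} (ha : 0 < a) (i : Fin 3) :
    newQubit a b i ≠ outQubit b (Nat.add_pos_left ha 3) :=
  fun h => newQubit_notMem_range i ⟨_, (outQubit_eq ha).symm.trans h.symm⟩

/-- When the second new qubit starts in the state `0`, the output of the check is the conjunction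
described at `checkCircuit`. -/
theorem exists_computes_checkCircuit {a : ℕ} (b : ℕ) (ha : 0 < a) :
    ∃ φ : Basis (Reg (a + 3) b) → Basis (Reg (a + 3) b), Computes (checkCircuit b ha) φ ∧
      ∀ (c : Basis (Fin 3)) (g : Basis (Reg a b)), c 1 = false →
        (Accepts (φ (glue c g)) ↔ c 0 = true ∧ ZeroPrivate g) := by
  have hto := newQubit_ne_outQubit (b := b) ha 1
  obtain ⟨ψ, h1, hmem, hnot⟩ := exists_computes_map_notGate _ (nodup_oldPrivate a b)
  have h2 := computes_multiNot (newQubit a b (0 : Fin 3) :: oldPrivate a b)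
    (t := newQubit a b 1) (d := newQubit a b 2) (by simp [newQubit_inj])
    (by simp [newQubit_inj, newQubit_notMem_oldPrivate])
    (by simp [newQubit_inj, newQubit_notMem_oldPrivate])
  have h3 := computes_cnotGate hto.symm
  have h4 := computes_cnotGate hto
  refine ⟨_, h1.append (h2.append (h3.append (h4.append h3))), fun c g hc => ?_⟩
  rw [accepts_iff (Nat.add_pos_left ha 3)]
  simp only [Function.comp_apply, Function.update_self, Function.update_of_ne hto,
    Function.update_of_ne hto.symm, hnot _ _ (newQubit_notMem_oldPrivate _), glue_new, hc,
    Bool.false_xor, List.all_cons]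
  have hall : (oldPrivate a b).all (ψ (glue c g)) = true ↔ ZeroPrivate g := by
    rw [List.all_eq_true]
    constructor
    · intro h i
      have hi : regEmb a 3 b (Sum.inl i) ∈ oldPrivate a b :=
        List.mem_map.2 ⟨i, List.mem_finRange i, rfl⟩
      have := h _ hi
      rwa [hmem _ _ hi, glue_old, Bool.not_eq_true'] at this
    · rintro h x hx
      rw [hmem _ _ hx]
      obtain ⟨i, -, rfl⟩ := List.mem_map.1 hx
      rw [glue_old, h i, Bool.not_false]
  rw [← hall]
  generalize (oldPrivate a b).all (ψ (glue c g)) = w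
  generalize ψ (glue c g) (outQubit b (Nat.add_pos_left ha 3)) = v
  cases c 0 <;> cases w <;> cases v <;> decide

/-- Run `U`, copy the output, undo `U`, and accept if the copy is `1` and the private qubits have
come back to `0`. -/
def squareLayer {a b : ℕ} (ha : 0 < a) (U : Unitary (Reg a b)) : Unitary (Reg (a + 3) b) :=
  evalCircuit (checkCircuit b ha) * ((lift (regEmb a 3 b) U)⁻¹ *
    (evalCircuit (cnotGate (outQubit b (Nat.add_pos_left ha 3)) (newQubit a b (0 : Fin 3))) *
      lift (regEmb a 3 b) U))

theorem glue_zero_pad (a b d : ℕ) (h : Basis (Fin b)) :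
    glue (fun _ : Fin d => false) (pad a h) = pad (a + d) h := by
  refine Eq.trans ?_ ((eq_glue_iff (a := a) (b := b) (fun _ : Fin d => false)
    (pad (a + d) h)).2 fun i => rfl).symm
  congr 1
  funext x
  rcases x with i | j <;> rfl

/-- Copying the output of the subroutine into the first new qubit. -/
theorem copy_mul_glue {a : ℕ} (b : ℕ) (ha : 0 < a) :
    (evalCircuit (cnotGate (outQubit b (Nat.add_pos_left ha 3)) (newQubit a b (0 : Fin 3)))).1 *
        glueMatrix a b (fun _ : Fin 3 => false) =
      glueMatrix a b ![true, false, false] * acceptProj a b +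
        glueMatrix a b (fun _ : Fin 3 => false) * (1 - acceptProj a b) := by
  have h := computes_cnotGate (newQubit_ne_outQubit (b := b) ha 0)
  rw [h, glueMatrix, fnMatrix_comp, acceptProj_eq]
  refine fnMatrix_ite _ _ _ _ (fun g hg => ?_) (fun g hg => ?_)
  · rw [accepts_iff ha] at hg
    have hv : (glue (fun _ : Fin 3 => false) g (newQubit a b 0) ^^
        glue (fun _ : Fin 3 => false) g (outQubit b (Nat.add_pos_left ha 3))) = true := by
      rw [outQubit_eq ha, glue_new, glue_old, hg]
      rfl
    simp only [Function.comp_apply, hv]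
    funext x
    rcases mem_range_or_newQubit x with ⟨y, rfl⟩ | ⟨i, rfl⟩
    · rw [Function.update_of_ne fun h => newQubit_notMem_range _ ⟨_, h⟩, glue_old, glue_old]
    · fin_cases i <;> simp [newQubit_inj, glue_new]
  · rw [accepts_iff ha, Bool.not_eq_true] at hg
    have hv : (glue (fun _ : Fin 3 => false) g (newQubit a b 0) ^^
        glue (fun _ : Fin 3 => false) g (outQubit b (Nat.add_pos_left ha 3))) =
          glue (fun _ : Fin 3 => false) g (newQubit a b 0) := by
      rw [outQubit_eq ha, glue_old, hg, Bool.xor_false]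
    simp only [Function.comp_apply, hv, Function.update_eq_self]

/-- With `Π` the acceptance projection and `P` the isometry that adds private qubits in the
state `0`, the amplitude `P† U† Π U P` of accepting, undoing `U` and finding all private qubits
in the state `0` is the acceptance operator itself; it is hermitian, so that its square is the
acceptance operator of the whole. -/
theorem acceptOp_squareLayer {a b : ℕ} (ha : 0 < a) (U : Unitary (Reg a b)) :
    acceptOp (squareLayer ha U) = acceptOp U * acceptOp U := by
  obtain ⟨φ, hφ, hφ'⟩ := exists_computes_checkCircuit b ha
  set c0 : Basis (Fin 3) := fun _ => false with hc0
  set c1 : Basis (Fin 3) := ![true, false, false] with hc1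
  set R := evalCircuit (checkCircuit b ha) with hR
  set L := lift (regEmb a 3 b) U with hL
  set N := evalCircuit (cnotGate (outQubit b (Nat.add_pos_left ha 3)) (newQubit a b (0 : Fin 3)))
    with hN
  set A0 : Matrix (Basis (Reg a b)) (Basis (Fin b)) ℂ :=
    U.1ᴴ * ((1 - acceptProj a b) * (U.1 * padMatrix a b)) with hA0
  set A1 : Matrix (Basis (Reg a b)) (Basis (Fin b)) ℂ :=
    U.1ᴴ * (acceptProj a b * (U.1 * padMatrix a b)) with hA1
  have hpad : padMatrix (a + 3) b = glueMatrix a b c0 * padMatrix a b := by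
    rw [padMatrix, glueMatrix, padMatrix, fnMatrix_comp]
    congr 1
    funext h
    exact (glue_zero_pad a b 3 h).symm
  have hLE : ∀ c : Basis (Fin 3), L.1 * glueMatrix a b c = glueMatrix a b c * U.1 :=
    fun c => lift_mul_glue U c
  have hLE' : ∀ c : Basis (Fin 3), (L⁻¹).1 * glueMatrix a b c = glueMatrix a b c * U.1ᴴ := by
    intro c
    rw [hL, ← map_inv]
    exact lift_mul_glue U⁻¹ c
  have hNE : N.1 * glueMatrix a b c0 =
      glueMatrix a b c1 * acceptProj a b + glueMatrix a b c0 * (1 - acceptProj a b) :=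
    copy_mul_glue b ha
  have hS : (squareLayer ha U).1 = R.1 * ((L⁻¹).1 * (N.1 * L.1)) := rfl
  have hc00 : c0 0 = false := rfl
  have hc01 : c0 1 = false := rfl
  have hc10 : c1 0 = true := rfl
  have hc11 : c1 1 = false := rfl
  have hM : (padMatrix a b)ᴴ * A1 = acceptOp U := rfl
  have hM' : A1ᴴ * padMatrix a b = acceptOp U := by
    rw [← (posSemidef_acceptOp U).isHermitian.eq, ← hM, Matrix.conjTranspose_mul _ A1,
      Matrix.conjTranspose_conjTranspose]
  have hφR : R.1ᴴ * (acceptProj (a + 3) b * R.1) = basisProj (Accepts ∘ φ) := by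
    rw [acceptProj_eq]
    exact hφ.conj_basisProj _
  clear_value c0 c1 R L N
  have hrun : (squareLayer ha U).1 * padMatrix (a + 3) b =
      R.1 * (glueMatrix a b c1 * A1 + glueMatrix a b c0 * A0) := by
    have e2 : N.1 * (L.1 * glueMatrix a b c0) =
        glueMatrix a b c1 * (acceptProj a b * U.1) +
          glueMatrix a b c0 * ((1 - acceptProj a b) * U.1) := by
      rw [hLE, ← Matrix.mul_assoc, hNE, Matrix.add_mul, Matrix.mul_assoc, Matrix.mul_assoc]
    have e1 : (squareLayer ha U).1 * padMatrix (a + 3) b =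
        R.1 * ((L⁻¹).1 * (N.1 * (L.1 * glueMatrix a b c0) * padMatrix a b)) := by
      rw [hpad, hS]
      simp only [Matrix.mul_assoc]
    rw [e1, e2, Matrix.add_mul, Matrix.mul_add, hA0, hA1]
    simp only [← Matrix.mul_assoc, hLE']
  clear_value A0 A1
  have hQ0 : basisProj (Accepts ∘ φ) * glueMatrix a b c0 = 0 := by
    rw [glueMatrix, basisProj_mul_fnMatrix, basisProj_false, Matrix.mul_zero]
    intro g
    rw [Function.comp_apply, Function.comp_apply, hφ' c0 g hc01]
    simp [hc00]
  have hQ1 : basisProj (Accepts ∘ φ) * glueMatrix a b c1 =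
      glueMatrix a b c1 * (padMatrix a b * (padMatrix a b)ᴴ) := by
    rw [glueMatrix, basisProj_mul_fnMatrix, pad_mul_conjTranspose]
    congr 1
    refine basisProj_congr fun g => ?_
    rw [Function.comp_apply, Function.comp_apply, hφ' c1 g hc11]
    simp [hc10]
  have h11 : (glueMatrix a b c1)ᴴ * glueMatrix a b c1 = 1 :=
    conjTranspose_fnMatrix_mul_self (leftInverse_glue c1).injective
  have h01 : (glueMatrix a b c0)ᴴ * glueMatrix a b c1 = 0 :=
    conjTranspose_fnMatrix_mul_of_ne fun x y h => by
      have := congrFun h (newQubit a b 0)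
      rw [glue_new, glue_new] at this
      simp [hc00, hc10] at this
  set B := glueMatrix a b c1 * A1 + glueMatrix a b c0 * A0 with hB
  have hacc : acceptOp (squareLayer ha U) =
      Bᴴ * ((R.1ᴴ * (acceptProj (a + 3) b * R.1)) * B) := by
    have : acceptOp (squareLayer ha U) =
        ((squareLayer ha U).1 * padMatrix (a + 3) b)ᴴ * (acceptProj (a + 3) b *
          ((squareLayer ha U).1 * padMatrix (a + 3) b)) := by
      rw [acceptOp, Matrix.conjTranspose_mul, Matrix.mul_assoc]
    rw [this, hrun, Matrix.conjTranspose_mul]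
    simp only [Matrix.mul_assoc]
  clear_value B
  have hQB : basisProj (Accepts ∘ φ) * B =
      glueMatrix a b c1 * (padMatrix a b * acceptOp U) := by
    rw [hB, Matrix.mul_add, ← Matrix.mul_assoc, ← Matrix.mul_assoc, hQ0, hQ1, Matrix.zero_mul,
      add_zero, Matrix.mul_assoc, Matrix.mul_assoc, hM]
  rw [hacc, hφR, hQB, hB, Matrix.conjTranspose_add, Matrix.conjTranspose_mul,
    Matrix.conjTranspose_mul, Matrix.add_mul]
  have t1 : A1ᴴ * (glueMatrix a b c1)ᴴ * (glueMatrix a b c1 * (padMatrix a b * acceptOp U)) =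
      acceptOp U * acceptOp U := by
    rw [Matrix.mul_assoc, ← Matrix.mul_assoc (glueMatrix a b c1)ᴴ, h11, Matrix.one_mul,
      ← Matrix.mul_assoc, hM']
  have t0 : A0ᴴ * (glueMatrix a b c0)ᴴ * (glueMatrix a b c1 * (padMatrix a b * acceptOp U)) =
      0 := by
    rw [Matrix.mul_assoc, ← Matrix.mul_assoc (glueMatrix a b c0)ᴴ, h01, Matrix.zero_mul,
      Matrix.mul_zero]
  rw [t1, t0, add_zero]

/-! ### Nested layers as one sequence of steps -/

/-- Negate the output if `m` is true. -/
def negIf {a : ℕ} (b : ℕ) (ha : 0 < a) (m : Bool) : List (Gate (Reg a b)) :=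
  if m then [notGate (outQubit b ha)] else []

/-- One amplification layer; the `or` of two trials is obtained from the `and` by negations. -/
def ampLayer {a b : ℕ} (ha : 0 < a) (m : Bool) (U : Unitary (Reg a b)) :
    Unitary (Reg (a + 3) b) :=
  evalCircuit (negIf b (Nat.add_pos_left ha 3) m) *
    squareLayer ha (evalCircuit (negIf b ha m) * U)

/-- Nested amplification layers; the head of the list is the outermost one. -/
def amplify {a b : ℕ} (ha : 0 < a) (U : Unitary (Reg a b)) :
    (ms : List Bool) → Unitary (Reg (a + 3 * ms.length) b)
  | [] => U
  | m :: ms => ampLayer (Nat.add_pos_left ha (3 * ms.length)) m (amplify ha U ms)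

/-- A step, regarded as a step with three more private qubits. -/
def Step.embed {a d b : ℕ} : Step a d b → Step a (d + 3) b
  | .gate g => .gate (g.map (regEmb (a + d) 3 b))
  | .call => .call
  | .callInv => .callInv

/-- The inverse of a step. -/
def Step.inv {a d b : ℕ} : Step a d b → Step a d b
  | .gate g => .gate g
  | .call => .callInv
  | .callInv => .call

/-- Gates as steps; the private qubits are counted as in the recursion for `ampSteps`. -/
def gateSteps {a d b : ℕ} (gs : List (Gate (Reg (a + d + 3) b))) : List (Step a (d + 3) b) :=
  gs.map (Step.gate (a := a) (d := d + 3) (b := b))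

/-- The sequence of steps that performs `amplify`. -/
def ampSteps {a : ℕ} (b : ℕ) (ha : 0 < a) : (ms : List Bool) → List (Step a (3 * ms.length) b)
  | [] => [.call]
  | m :: ms =>
    let ha' : 0 < a + 3 * ms.length := Nat.add_pos_left ha _
    let Q : List (Step a (3 * ms.length) b) := ampSteps b ha ms ++ (negIf b ha' m).map .gate
    Q.map Step.embed ++
      (gateSteps (cnotGate (outQubit b (Nat.add_pos_left ha' 3)) (newQubit _ b (0 : Fin 3))) ++
        ((Q.map Step.inv).reverse.map Step.embed ++
          (gateSteps (checkCircuit b ha') ++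
            gateSteps (negIf b (Nat.add_pos_left ha' 3) m))))

section Steps

variable {a d b : ℕ} (U : Unitary (Reg a b))

theorem evalSteps_append (l₁ l₂ : List (Step a d b)) :
    evalSteps U (l₁ ++ l₂) = evalSteps U l₂ * evalSteps U l₁ := by
  induction l₁ with
  | nil => simp [evalSteps]
  | cons g gs ih => simp [evalSteps, ih, mul_assoc]

theorem evalSteps_gates (gs : List (Gate (Reg (a + d) b))) :
    evalSteps U (gs.map Step.gate) = evalCircuit gs := by
  induction gs with
  | nil => rfl
  | cons g gs ih => rw [List.map_cons, evalSteps, ih, evalCircuit, Step.eval]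

theorem evalSteps_gateSteps (gs : List (Gate (Reg (a + d + 3) b))) :
    evalSteps U (gateSteps gs) = evalCircuit gs :=
  evalSteps_gates (d := d + 3) U gs

theorem regEmb_trans : (regEmb a d b).trans (regEmb (a + d) 3 b) = regEmb a (d + 3) b := by
  ext x
  rcases x with i | j <;> rfl

theorem evalSteps_embed (l : List (Step a d b)) :
    evalSteps U (l.map Step.embed) = lift (regEmb (a + d) 3 b) (evalSteps U l) := by
  induction l with
  | nil => exact (map_one _).symm
  | cons t l ih =>
    have : t.embed.eval U = lift (regEmb (a + d) 3 b) (t.eval U) := by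
      cases t with
      | gate g => exact Gate.eval_map _ g
      | call => rw [Step.eval, lift_lift, regEmb_trans]; rfl
      | callInv => rw [Step.eval, lift_lift, regEmb_trans]; rfl
    rw [List.map_cons, evalSteps, evalSteps, ih, this, map_mul]

theorem evalSteps_inv (l : List (Step a d b)) :
    evalSteps U (l.map Step.inv).reverse = (evalSteps U l)⁻¹ := by
  induction l with
  | nil => simp [evalSteps]
  | cons t l ih =>
    have h : t.inv.eval U = (t.eval U)⁻¹ := by
      cases t with
      | gate g => exact (inv_eq_of_mul_eq_one_left g.eval_mul_self).symm
      | call => exact map_inv _ _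
      | callInv => rw [Step.eval, map_inv, inv_inv]; rfl
    have h1 : evalSteps U [t.inv] = t.inv.eval U := one_mul _
    rw [List.map_cons, List.reverse_cons, evalSteps_append, ih, h1, h, evalSteps, mul_inv_rev]

theorem evalSteps_ampSteps (ha : 0 < a) (ms : List Bool) :
    evalSteps U (ampSteps b ha ms) = amplify ha U ms := by
  induction ms with
  | nil =>
    have : evalSteps U (ampSteps b ha []) = 1 * lift (regEmb a 0 b) U := by
      rw [ampSteps]
      rfl
    rw [this, one_mul]
    exact lift_regEmb_zero U
  | cons m ms ih =>
    have ha' : 0 < a + 3 * ms.length := Nat.add_pos_left ha _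
    have hQ : evalSteps U (ampSteps b ha ms ++ (negIf b ha' m).map .gate) =
        evalCircuit (negIf b ha' m) * amplify ha U ms := by
      rw [evalSteps_append, evalSteps_gates, ih]
    rw [ampSteps]
    change evalSteps (d := 3 * ms.length + 3) U (_ ++ (_ ++ (_ ++ (_ ++ _)))) =
      ampLayer ha' m (amplify ha U ms)
    rw [evalSteps_append, evalSteps_append, evalSteps_append, evalSteps_append, evalSteps_embed,
      evalSteps_embed, evalSteps_inv, hQ, ampLayer, squareLayer, ← map_inv, evalSteps_gateSteps,
      evalSteps_gateSteps, evalSteps_gateSteps]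
    simp only [mul_assoc]

end Steps

theorem length_negIf {a : ℕ} (b : ℕ) (ha : 0 < a) (m : Bool) : (negIf b ha m).length ≤ 1 := by
  cases m <;> simp [negIf]

theorem length_ampSteps {a : ℕ} (b : ℕ) (ha : 0 < a) (ms : List Bool) :
    (ampSteps b ha ms).length ≤ 2 ^ (6 * (a + 3 * ms.length)) := by
  induction ms with
  | nil =>
    rw [ampSteps]
    exact Nat.one_le_two_pow
  | cons m ms ih =>
    have ha' : 0 < a + 3 * ms.length := Nat.add_pos_left ha _
    have h1 := length_negIf b ha' m
    have h2 := length_negIf b (Nat.add_pos_left ha' 3) m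
    have h3 := length_checkCircuit b ha'
    have h4 := length_cnotGate (outQubit b (Nat.add_pos_left ha' 3))
      (newQubit (a + 3 * ms.length) b (0 : Fin 3))
    have h5 : (ampSteps b ha (m :: ms)).length =
        ((ampSteps b ha ms).length + (negIf b ha' m).length) +
          ((cnotGate (outQubit b (Nat.add_pos_left ha' 3))
              (newQubit (a + 3 * ms.length) b (0 : Fin 3))).length +
            (((ampSteps b ha ms).length + (negIf b ha' m).length) +
              ((checkCircuit b ha').length +
                (negIf b (Nat.add_pos_left ha' 3) m).length))) := by
      rw [ampSteps]
      simp only [List.length_append, List.length_map, List.length_reverse, gateSteps]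
    have h6 : 2 ^ (6 * (a + 3 * (m :: ms).length)) =
        2 ^ (6 * (a + 3 * ms.length)) * 2 ^ 18 := by
      rw [List.length_cons, ← pow_add]
      congr 1
    have h7 : 2 ^ (a + 3 * ms.length) ≤ 2 ^ (6 * (a + 3 * ms.length)) :=
      Nat.pow_le_pow_right two_pos (by omega)
    have h8 : a + 3 * ms.length < 2 ^ (a + 3 * ms.length) := Nat.lt_two_pow_self
    rw [pow_succ] at h3
    rw [h5, h6]
    omega

/-! ### Acceptance probabilities of nested layers -/

theorem acceptOp_ampLayer {a b : ℕ} (ha : 0 < a) (m : Bool) (U : Unitary (Reg a b)) :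
    acceptOp (ampLayer ha m U) =
      if m then 1 - (1 - acceptOp U) * (1 - acceptOp U) else acceptOp U * acceptOp U := by
  cases m with
  | false => simp [ampLayer, negIf, evalCircuit, acceptOp_squareLayer]
  | true => simp only [ampLayer, negIf, if_true, acceptOp_not, acceptOp_squareLayer]

/-- The layers act on the eigenvalues of the acceptance operator, and keep its eigenvectors. -/
theorem exists_acceptOp_amplify {a b : ℕ} (ha : 0 < a) (U : Unitary (Reg a b)) :
    ∃ (S : Unitary (Fin b)) (lam : Basis (Fin b) → ℝ), (∀ i, lam i ∈ Set.Icc (0 : ℝ) 1) ∧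
      ∀ ms : List Bool, acceptOp (amplify ha U ms) =
        S.1 * Matrix.diagonal (fun i => ((runLayers ms (lam i) : ℝ) : ℂ)) * S.1ᴴ := by
  have hpos := posSemidef_acceptOp U
  have hH := hpos.isHermitian
  have hS1 := unitary_mul_conjTranspose hH.eigenvectorUnitary
  have hS2 := unitary_conjTranspose_mul hH.eigenvectorUnitary
  have hspec : acceptOp U = hH.eigenvectorUnitary.1 *
      Matrix.diagonal (fun i => ((hH.eigenvalues i : ℝ) : ℂ)) * hH.eigenvectorUnitary.1ᴴ := by
    conv_lhs => rw [hH.spectral_theorem]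
    rfl
  refine ⟨hH.eigenvectorUnitary, hH.eigenvalues, fun i => ⟨hpos.eigenvalues_nonneg i, ?_⟩, ?_⟩
  · have h1 : (1 - acceptOp U).PosSemidef := acceptOp_not ha U ▸ posSemidef_acceptOp _
    have h2 := (h1.conjTranspose_mul_mul_same hH.eigenvectorUnitary.1).diag_nonneg (i := i)
    have h3 : hH.eigenvectorUnitary.1ᴴ * (1 - acceptOp U) * hH.eigenvectorUnitary.1 =
        1 - Matrix.diagonal (fun i => ((hH.eigenvalues i : ℝ) : ℂ)) := by
      have h4 := congrArg
        (fun X => hH.eigenvectorUnitary.1ᴴ * X * hH.eigenvectorUnitary.1) hspec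
      have h5 : ∀ D : Matrix (Basis (Fin b)) (Basis (Fin b)) ℂ, hH.eigenvectorUnitary.1ᴴ *
          (hH.eigenvectorUnitary.1 * D * hH.eigenvectorUnitary.1ᴴ) *
            hH.eigenvectorUnitary.1 = D := by
        intro D
        calc _ = (hH.eigenvectorUnitary.1ᴴ * hH.eigenvectorUnitary.1) * D *
              (hH.eigenvectorUnitary.1ᴴ * hH.eigenvectorUnitary.1) := by
              simp only [Matrix.mul_assoc]
          _ = D := by rw [hS2, Matrix.one_mul, Matrix.mul_one]
      simp only [h5] at h4
      rw [Matrix.mul_sub, Matrix.sub_mul, Matrix.mul_one, hS2, h4]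
    rw [h3, Matrix.sub_apply, Matrix.one_apply_eq, Matrix.diagonal_apply_eq, sub_nonneg] at h2
    exact_mod_cast h2
  · intro ms
    generalize hH.eigenvectorUnitary = S at *
    have hmul : ∀ D D' : Basis (Fin b) → ℂ, (S.1 * Matrix.diagonal D * S.1ᴴ) *
        (S.1 * Matrix.diagonal D' * S.1ᴴ) = S.1 * Matrix.diagonal (fun i => D i * D' i) * S.1ᴴ := by
      intro D D'
      rw [← Matrix.diagonal_mul_diagonal]
      calc _ = S.1 * Matrix.diagonal D * (S.1ᴴ * S.1) * (Matrix.diagonal D' * S.1ᴴ) := by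
            simp only [Matrix.mul_assoc]
        _ = _ := by rw [hS2, Matrix.mul_one]; simp only [Matrix.mul_assoc]
    have hsub : ∀ D : Basis (Fin b) → ℂ, 1 - S.1 * Matrix.diagonal D * S.1ᴴ =
        S.1 * Matrix.diagonal (fun i => 1 - D i) * S.1ᴴ := by
      intro D
      have : Matrix.diagonal (fun i => 1 - D i) = 1 - Matrix.diagonal D := by
        rw [← Matrix.diagonal_one, Matrix.diagonal_sub]
      rw [this, Matrix.mul_sub, Matrix.mul_one, Matrix.sub_mul, hS1]
    induction ms with
    | nil => exact hspec
    | cons m ms ih =>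
      have : acceptOp (amplify ha U (m :: ms)) =
          acceptOp (ampLayer (Nat.add_pos_left ha (3 * ms.length)) m (amplify ha U ms)) := rfl
      rw [this, acceptOp_ampLayer, ih]
      cases m with
      | false =>
        rw [if_neg (by simp), hmul]
        congr 3
        funext i
        simp [runLayers, layer, sq]
      | true =>
        rw [if_pos rfl, hsub, hmul, hsub]
        congr 3
        funext i
        simp [runLayers, layer, sq]

/-- The acceptance probability averages the eigenvalues with weights given by the witness. -/
theorem exists_acceptProb_amplify {a b : ℕ} (ha : 0 < a) (U : Unitary (Reg a b)) :
    ∃ (lam : Basis (Fin b) → ℝ), (∀ i, lam i ∈ Set.Icc (0 : ℝ) 1) ∧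
      (∀ ρ, IsState ρ → ∃ w : Basis (Fin b) → ℝ, (∀ i, 0 ≤ w i) ∧ ∑ i, w i = 1 ∧
        ∀ ms, acceptProb (amplify ha U ms) ρ = ∑ i, runLayers ms (lam i) * w i) ∧
      ∀ i, ∃ ρ, IsState ρ ∧ ∀ ms, acceptProb (amplify ha U ms) ρ = runLayers ms (lam i) := by
  obtain ⟨S, lam, hlam, h⟩ := exists_acceptOp_amplify ha U
  have hS1 := unitary_mul_conjTranspose S
  have hS2 := unitary_conjTranspose_mul S
  have hprob : ∀ ms ρ, acceptProb (amplify ha U ms) ρ =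
      ∑ i, runLayers ms (lam i) * ((S.1ᴴ * ρ * S.1) i i).re := by
    intro ms ρ
    have : (S.1 * Matrix.diagonal (fun i => ((runLayers ms (lam i) : ℝ) : ℂ)) * S.1ᴴ * ρ).trace =
        (Matrix.diagonal (fun i => ((runLayers ms (lam i) : ℝ) : ℂ)) *
          (S.1ᴴ * ρ * S.1)).trace := by
      rw [Matrix.mul_assoc, Matrix.mul_assoc, Matrix.trace_mul_comm]
      simp only [Matrix.mul_assoc]
    rw [acceptProb_eq, h, this, Matrix.trace, Complex.re_sum]
    refine Finset.sum_congr rfl fun i _ => ?_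
    rw [Matrix.diag_apply, Matrix.diagonal_mul, Complex.re_ofReal_mul]
  refine ⟨lam, hlam, fun ρ hρ => ⟨fun i => ((S.1ᴴ * ρ * S.1) i i).re, fun i => ?_, ?_,
    fun ms => hprob ms ρ⟩, fun i => ?_⟩
  · have := (hρ.1.conjTranspose_mul_mul_same S.1).diag_nonneg (i := i)
    exact (Complex.nonneg_iff.1 this).1
  · have : (S.1ᴴ * ρ * S.1).trace = 1 := by
      rw [Matrix.trace_mul_comm, ← Matrix.mul_assoc, hS1, Matrix.one_mul, hρ.2]
    rw [← Complex.re_sum]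
    change (S.1ᴴ * ρ * S.1).trace.re = 1
    rw [this, Complex.one_re]
  · set E : Matrix (Basis (Fin b)) (Basis (Fin b)) ℂ :=
      Matrix.diagonal fun j => if j = i then 1 else 0 with hE
    have hconj : S.1ᴴ * (S.1 * E * S.1ᴴ) * S.1 = E := by
      calc _ = (S.1ᴴ * S.1) * E * (S.1ᴴ * S.1) := by simp only [Matrix.mul_assoc]
        _ = E := by rw [hS2, Matrix.one_mul, Matrix.mul_one]
    refine ⟨S.1 * E * S.1ᴴ, ⟨?_, ?_⟩, fun ms => ?_⟩
    · refine Matrix.PosSemidef.mul_mul_conjTranspose_same (Matrix.PosSemidef.diagonal fun j => ?_) _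
      by_cases hj : j = i <;> simp [hj]
    · rw [Matrix.trace_mul_comm, ← Matrix.mul_assoc, hS2, Matrix.one_mul, hE,
        Matrix.trace_diagonal]
      simp
    · rw [hprob, hconj, Finset.sum_eq_single i]
      · simp [hE]
      · intro j _ hj
        simp [hE, hj]
      · simp

theorem acceptProb_amplify_complete {a b : ℕ} (ha : 0 < a) (U : Unitary (Reg a b)) {c : ℝ}
    (hc : 0 ≤ c) (h : ∃ ρ, IsState ρ ∧ c ≤ acceptProb U ρ) (ms : List Bool) :
    ∃ ρ, IsState ρ ∧ runLayers ms c ≤ acceptProb (amplify ha U ms) ρ := by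
  obtain ⟨lam, hlam, hav, heig⟩ := exists_acceptProb_amplify ha U
  obtain ⟨ρ, hρ, hcρ⟩ := h
  obtain ⟨w, hw, hw1, hsum⟩ := hav ρ hρ
  obtain ⟨i, hi⟩ := Finite.exists_max lam
  have hci : c ≤ lam i := by
    calc c ≤ acceptProb U ρ := hcρ
      _ = ∑ j, lam j * w j := hsum []
      _ ≤ ∑ j, lam i * w j :=
        Finset.sum_le_sum fun j _ => mul_le_mul_of_nonneg_right (hi j) (hw j)
      _ = lam i := by rw [← Finset.mul_sum, hw1, mul_one]
  obtain ⟨ρ', hρ', h'⟩ := heig i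
  exact ⟨ρ', hρ', (h' ms).symm ▸ runLayers_mono ms hc (hlam i).2 hci⟩

theorem acceptProb_amplify_sound {a b : ℕ} (ha : 0 < a) (U : Unitary (Reg a b)) {s : ℝ}
    (hs : s ≤ 1) (h : ∀ ρ, IsState ρ → acceptProb U ρ ≤ s) (ms : List Bool)
    {ρ : Matrix (Basis (Fin b)) (Basis (Fin b)) ℂ} (hρ : IsState ρ) :
    acceptProb (amplify ha U ms) ρ ≤ runLayers ms s := by
  obtain ⟨lam, hlam, hav, heig⟩ := exists_acceptProb_amplify ha U
  obtain ⟨w, hw, hw1, hsum⟩ := hav ρ hρ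
  have hls : ∀ i, lam i ≤ s := by
    intro i
    obtain ⟨ρ', hρ', h'⟩ := heig i
    exact (h' []).symm.trans_le (h ρ' hρ')
  calc acceptProb (amplify ha U ms) ρ = ∑ i, runLayers ms (lam i) * w i := hsum ms
    _ ≤ ∑ i, runLayers ms s * w i := Finset.sum_le_sum fun i _ =>
        mul_le_mul_of_nonneg_right (runLayers_mono ms (hlam i).1 hs (hls i)) (hw i)
    _ = runLayers ms s := by rw [← Finset.mul_sum, hw1, mul_one]

end SpaceQMA

end

theorem theorem1 :
    ∃ C : ℝ, ∀ (p lV lM : ℕ → ℕ) (c s : ℕ → ℝ),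
      (∀ n, 1 ≤ p n) → (∀ n, 1 ≤ lV n) →
      (∀ n, c n ∈ Set.Icc (0 : ℝ) 1) → (∀ n, s n ∈ Set.Icc (0 : ℝ) 1) → (∀ n, s n < c n) →
      ∃ δ : ℕ → ℕ,
        (∀ n, (δ n : ℝ) ≤ C * Real.logb 2 ((p n : ℝ) / (c n - s n))) ∧
        ∀ 𝓜 : SpaceQMA.UnitaryModel,
          SpaceQMA.QMAUSPACE 𝓜 lV lM c s ⊆
            SpaceQMA.QMAUSPACE 𝓜 (lV + δ) lM
              (fun n => 1 - (2 : ℝ)⁻¹ ^ p n) (fun n => (2 : ℝ)⁻¹ ^ p n) := by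
  refine ⟨684, fun p lV lM c s hp hlV hc hs hsc => ?_⟩
  choose ms hlen hyes hno using fun n => SpaceQMA.exists_layers (hp n) (hs n).1 (hc n).2 (hsc n)
  refine ⟨fun n => 3 * (ms n).length, hlen, ?_⟩
  rintro 𝓜 A ⟨V, hV, hA⟩
  refine ⟨_, 𝓜.subroutine hV (fun n => 3 * (ms n).length) 6
    (fun n => SpaceQMA.ampSteps (lM n) (hlV n) (ms n)) fun n =>
      (SpaceQMA.length_ampSteps (lM n) (hlV n) (ms n)).trans
        (Nat.pow_le_pow_right two_pos (Nat.mul_le_mul_left 6 (Nat.le_add_right _ _))), fun x => ?_⟩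
  dsimp only
  have hx := SpaceQMA.evalSteps_ampSteps (V x) (hlV x.length) (ms x.length)
  constructor
  · intro hxy
    obtain ⟨ρ, hρ, h⟩ := SpaceQMA.acceptProb_amplify_complete (hlV x.length) (V x)
      (hc x.length).1 ((hA x).1 hxy) (ms x.length)
    refine ⟨ρ, hρ, (hyes x.length).trans (h.trans_eq ?_)⟩
    rw [← hx]
  · intro hxn ρ hρ
    have h := SpaceQMA.acceptProb_amplify_sound (hlV x.length) (V x) (hs x.length).2
      ((hA x).2 hxn) (ms x.length) hρ
    refine le_trans (le_of_eq ?_) (h.trans (hno x.length))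
    rw [← hx]
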